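/- Let $V$ be a complete discrete valuation ring with uniformizer $\pi$, fix $0<\epsilon<1$ (the absolute value of $\pi$), and let $R$ be a finitely generated commutative (unital) $V$-algebra. **Bornologies.** A (convex) bornology on a $V$-module $M$ is a family of "bounded" subsets that contains all finite subsets and is closed under subsets, finite unions and passage to generated $V$-submodules. In the fine bornology a set is bounded iff it is contained in a finitely generated submodule. For $S\subseteq M$, a sequence $(x_n)$ $S$-converges to $x$ if there are $\delta_n\in V$ with $\delta_n\to0$ $\pi$-adically and $x_n-x\in\delta_nS$ for all $n$; it is $S$-Cauchy if there are such $\delta_n$ with $x_n-x_m\in\delta_lS$ for all $n,m\ge l$. $M$ is separated if limits of sequences that $S$-converge for some bounded $S$ are unique, and complete if it is separated and for each bounded $S$ there is a bounded $S'$ such that every $S$-Cauchy sequence is $S'$-convergent. A completion of $M$ is a complete bornological module $\overline M$ with a bounded linear map $M\to\overline M$ through which every bounded linear map from $M$ to a complete bornological module factors uniquely by a bounded linear map. A bornological algebra is a unital associative $V$-algebra with a bornology for which products of bounded sets are bounded. **Linear growth.** For a bounded submodule $M$ of a bornological algebra, $\varrho(M)\le1$ means that the infimum of all $r\ge1$ for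 which $\sum_{n\ge0}\pi^{\lceil \log_\epsilon(r^{-n})\rceil}M^n$ is bounded is at most $1$. The linear growth bornology on $R$ (for the fine bornology) is the smallest algebra bornology that contains the fine bornology and for which all bounded submodules $M$ satisfy $\varrho(M)\le1$. Let $\overline{R}_{\mathrm{lg}}$ be the completion of $R$ for the linear growth bornology, with its bornological algebra structure extending the multiplication of $R$. **Weak completion.** Let $R^\dagger\subseteq\widehat R=\varprojlim_j R/\pi^jR$ be the set of all $z=\sum_{j\ge0}\pi^jw_j$ with $w_j\in M^{\kappa_j}$ and $\kappa_j\le c(j+1)$ for some finitely generated $V$-submodule $M\ni1$ of $R$ and some constant $c>0$. A subset of $R^\dagger$ is bounded if all its elements are of this form with a fixed $M$ and a fixed $c$. **Theorem.** The canonical map $R\to R^\dagger$ extends uniquely to an isomorphism of bornological algebras from $\overline{R}_{\mathrm{lg}}$ onto $R^\dagger$. That is: (i) $R^\dagger$ is a bornological algebra; (ii) $R^\dagger$ with the canonical map $R\to R^\dagger$ is a completion of $R$ for the linear growth bornology; (iii) if $C$ is any bornological algebra with an algebra homomorphism $\iota\colon R\to C$ that is a completion of $R$ for the linear growth bornology,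 then there is an algebra isomorphism $\varphi\colon C\to R^\dagger$, bounded with bounded inverse, such that $\varphi\circ\iota$ is the canonical map, and $\varphi$ is the only bounded $V$-linear map $C\to R^\dagger$ with this property. -/

import Mathlib

open scoped Pointwise

namespace MW

/-! ### Convex bornologies on modules over a commutative ring `V` -/

/-- A (convex) bornology on a `V`-module `M`: a bornology (finite sets are bounded, subsets and
finite unions of bounded sets are bounded) such that the `V`-submodule generated by a bounded set
is bounded. -/
structure ConvexBornology (V : Type*) (M : Type*) [CommRing V] [AddCommGroup M] [Module V M]
    extends Bornology M where
  isBounded_span : ∀ S : Set M, @Bornology.IsBounded M toBornology S →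
    @Bornology.IsBounded M toBornology (Submodule.span V S : Set M)

section Modules

variable {V : Type*} [CommRing V]
variable {M : Type*} [AddCommGroup M] [Module V M]
variable {N : Type*} [AddCommGroup N] [Module V N]

/-- The bounded subsets of a convex bornology. -/
def ConvexBornology.Bdd (B : ConvexBornology V M) (S : Set M) : Prop :=
  @Bornology.IsBounded M B.toBornology S

/-- A convex bornology from its family of bounded subsets. -/
def ConvexBornology.ofBdd (P : Set (Set M)) (h0 : ∅ ∈ P)
    (hsub : ∀ s ∈ P, ∀ t ⊆ s, t ∈ P) (hun : ∀ s ∈ P, ∀ t ∈ P, s ∪ t ∈ P)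
    (hsing : ∀ x, {x} ∈ P) (hspan : ∀ s ∈ P, (Submodule.span V s : Set M) ∈ P) :
    ConvexBornology V M where
  toBornology := Bornology.ofBounded P h0 hsub hun hsing
  isBounded_span := fun S hS => by
    rw [Bornology.isBounded_ofBounded_iff] at hS ⊢
    exact hspan S hS

theorem ConvexBornology.bdd_ofBdd {P : Set (Set M)} {h0 hsub hun hsing}
    {hspan : ∀ s ∈ P, (Submodule.span V s : Set M) ∈ P} (S : Set M) :
    (ConvexBornology.ofBdd P h0 hsub hun hsing hspan).Bdd S ↔ S ∈ P :=
  Bornology.isBounded_ofBounded_iff (sUnion_univ := hsing) P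

theorem ConvexBornology.bdd_empty (B : ConvexBornology V M) : B.Bdd ∅ :=
  @Bornology.isBounded_empty M B.toBornology

theorem ConvexBornology.bdd_singleton (B : ConvexBornology V M) (x : M) : B.Bdd {x} :=
  @Bornology.isBounded_singleton M B.toBornology x

theorem ConvexBornology.Bdd.subset {B : ConvexBornology V M} {S T : Set M} (h : B.Bdd S)
    (hT : T ⊆ S) : B.Bdd T :=
  @Bornology.IsBounded.subset M B.toBornology T S h hT

theorem ConvexBornology.Bdd.union {B : ConvexBornology V M} {S T : Set M} (hS : B.Bdd S)
    (hT : B.Bdd T) : B.Bdd (S ∪ T) :=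
  @Bornology.IsBounded.union M B.toBornology S T hS hT

theorem ConvexBornology.Bdd.span {B : ConvexBornology V M} {S : Set M} (hS : B.Bdd S) :
    B.Bdd (Submodule.span V S : Set M) :=
  B.isBounded_span S hS

/-- The fine bornology: the bounded sets are the subsets of finitely generated submodules. -/
def fineBornology (V : Type*) (M : Type*) [CommRing V] [AddCommGroup M] [Module V M] :
    ConvexBornology V M :=
  ConvexBornology.ofBdd {S | ∃ F : Submodule V M, F.FG ∧ S ⊆ F}
    ⟨⊥, Submodule.fg_bot, Set.empty_subset _⟩
    (fun _ ⟨F, hF, h⟩ _ ht => ⟨F, hF, ht.trans h⟩)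
    (fun _ ⟨F, hF, h⟩ _ ⟨G, hG, h'⟩ => ⟨F ⊔ G, hF.sup hG, Set.union_subset
      (h.trans (SetLike.coe_subset_coe.2 le_sup_left))
      (h'.trans (SetLike.coe_subset_coe.2 le_sup_right))⟩)
    (fun x => ⟨Submodule.span V {x}, Submodule.fg_span_singleton x, Submodule.subset_span⟩)
    (fun _ ⟨F, hF, h⟩ => ⟨F, hF, SetLike.coe_subset_coe.2 (Submodule.span_le.2 h)⟩)

/-- A map is bounded if it maps bounded sets to bounded sets. -/
def IsBoundedMap (B : ConvexBornology V M) (B' : ConvexBornology V N) (f : M → N) : Prop :=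
  ∀ S, B.Bdd S → B'.Bdd (f '' S)

/-- `δ` converges to `0` in the `π`-adic topology of `V`. -/
def TendsToZero (π : V) (δ : ℕ → V) : Prop :=
  ∀ k : ℕ, ∃ n₀ : ℕ, ∀ n ≥ n₀, π ^ k ∣ δ n

/-- The sequence `x` `S`-converges to `a`. -/
def SConverges (π : V) (S : Set M) (x : ℕ → M) (a : M) : Prop :=
  ∃ δ : ℕ → V, TendsToZero π δ ∧ ∀ n, x n - a ∈ δ n • S

/-- The sequence `x` is `S`-Cauchy. -/
def SCauchy (π : V) (S : Set M) (x : ℕ → M) : Prop :=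
  ∃ δ : ℕ → V, TendsToZero π δ ∧ ∀ n m l, l ≤ n → l ≤ m → x n - x m ∈ δ l • S

/-- Limits of (bornologically) convergent sequences are unique. -/
def IsSeparated (π : V) (B : ConvexBornology V M) : Prop :=
  ∀ (S T : Set M) (x : ℕ → M) (a b : M), B.Bdd S → B.Bdd T →
    SConverges π S x a → SConverges π T x b → a = b

/-- Completeness of a bornological `V`-module. -/
def IsComplete (π : V) (B : ConvexBornology V M) : Prop :=
  IsSeparated π B ∧
    ∀ S, B.Bdd S → ∃ S', B.Bdd S' ∧ ∀ x : ℕ → M, SCauchy π S x → ∃ a, SConverges π S' x a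

end Modules

/-- `(N, B')` together with `ι : M → N` is a completion of the bornological `V`-module `(M, B)`:
it is complete, `ι` is bounded, and every bounded linear map from `M` to a complete bornological
`V`-module `Y` (in the universe `w`) factors uniquely through `ι` by a bounded linear map. -/
def IsCompletion.{w, v, u₁, u₂} {V : Type v} [CommRing V] {M : Type u₁} [AddCommGroup M]
    [Module V M] {N : Type u₂} [AddCommGroup N] [Module V N] (π : V)
    (B : ConvexBornology V M) (B' : ConvexBornology V N) (ι : M →ₗ[V] N) : Prop :=
  IsComplete π B' ∧ IsBoundedMap B B' ι ∧
    ∀ (Y : Type w) [AddCommGroup Y] [Module V Y] (BY : ConvexBornology V Y),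
      IsComplete π BY → ∀ f : M →ₗ[V] Y, IsBoundedMap B BY f →
        ∃! g : N →ₗ[V] Y, IsBoundedMap B' BY g ∧ g ∘ₗ ι = f

/-! ### Bornological algebras, spectral radius and linear growth -/

section Algebras

variable {V : Type*} [CommRing V]
variable {R : Type*} [Ring R] [Algebra V R]

/-- The multiplication is bounded, that is, `(R, B)` is a bornological algebra. -/
def IsAlgebraBornology (B : ConvexBornology V R) : Prop :=
  ∀ S T, B.Bdd S → B.Bdd T → B.Bdd (S * T)

/-- `r ⋆ M = π ^ ⌈log_ε r⌉ M` for `0 < r ≤ 1`, where `ε = |π|`; the exponent is then the smallest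
(natural) number `j` with `ε ^ j ≤ r`. -/
noncomputable def star (π : V) (ε r : ℝ) (M : Submodule V R) : Submodule V R :=
  (π ^ ⌈Real.logb ε r⌉₊) • M

/-- The submodule `∑ₙ r⁻ⁿ ⋆ Mⁿ` of all finite sums of elements of the sets `r⁻ⁿ ⋆ Mⁿ`, for
`1 ≤ r`. -/
noncomputable def powerSum (π : V) (ε r : ℝ) (M : Submodule V R) : Submodule V R :=
  ⨆ n : ℕ, star π ε ((r ^ n)⁻¹) (M ^ n)

/-- The infimum of all `r ≥ 1` for which `∑ₙ r⁻ⁿ ⋆ Mⁿ` is bounded (`∞` if there is none). In a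
`V`-algebra these sums are only available for `r ≥ 1`; they give a meaning to the assertion
that the spectral radius of `M` is at most `ρ`, for `ρ ≥ 1`. -/
noncomputable def specRadius (π : V) (ε : ℝ) (B : ConvexBornology V R) (M : Submodule V R) :
    ENNReal :=
  sInf {ρ | ∃ r : ℝ, 1 ≤ r ∧ B.Bdd (powerSum π ε r M : Set R) ∧ ρ = ENNReal.ofReal r}

/-- The admissible bornologies in the definition of the linear growth bornology: algebra
bornologies `B'` that contain `B` and for which all bounded submodules have spectral radius at
most `1`. -/
def IsGrowthBornology (π : V) (ε : ℝ) (B B' : ConvexBornology V R) : Prop :=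
  IsAlgebraBornology B' ∧ (∀ S, B.Bdd S → B'.Bdd S) ∧
    ∀ M : Submodule V R, B'.Bdd (M : Set R) → specRadius π ε B' M ≤ 1

/-- The linear growth bornology: the smallest admissible bornology
(see `linearGrowth_isGrowthBornology` and `linearGrowth_le`). -/
def linearGrowth (π : V) (ε : ℝ) (B : ConvexBornology V R) : ConvexBornology V R :=
  ConvexBornology.ofBdd {S | ∀ B', IsGrowthBornology π ε B B' → B'.Bdd S}
    (fun B' _ => B'.bdd_empty)
    (fun _ hs _ ht B' hB' => (hs B' hB').subset ht)
    (fun _ hs _ ht B' hB' => (hs B' hB').union (ht B' hB'))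
    (fun x B' _ => B'.bdd_singleton x)
    (fun _ hs B' hB' => (hs B' hB').span)

theorem bdd_linearGrowth {π : V} {ε : ℝ} {B : ConvexBornology V R} {S : Set R} :
    (linearGrowth π ε B).Bdd S ↔ ∀ B', IsGrowthBornology π ε B B' → B'.Bdd S :=
  ConvexBornology.bdd_ofBdd S

theorem linearGrowth_le {π : V} {ε : ℝ} {B B' : ConvexBornology V R}
    (h : IsGrowthBornology π ε B B') {S : Set R} (hS : (linearGrowth π ε B).Bdd S) : B'.Bdd S :=
  bdd_linearGrowth.1 hS B' h

theorem star_mono {π : V} {ε r s : ℝ} (hε0 : 0 < ε) (hε1 : ε < 1) (hr : 0 < r) (hrs : r ≤ s)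
    (M : Submodule V R) : star π ε r M ≤ star π ε s M := by
  have h1 : ⌈Real.logb ε s⌉₊ ≤ ⌈Real.logb ε r⌉₊ :=
    Nat.ceil_le_ceil ((Real.logb_le_logb_of_base_lt_one hε0 hε1 (hr.trans_le hrs) hr).2 hrs)
  obtain ⟨k, hk⟩ := Nat.exists_eq_add_of_le h1
  unfold star
  rw [hk, pow_add, mul_smul]
  refine Submodule.map_mono ?_
  rintro _ ⟨m, hm, rfl⟩
  exact M.smul_mem _ hm

theorem specRadius_le_one_iff {π : V} {ε : ℝ} (hε0 : 0 < ε) (hε1 : ε < 1)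
    {B : ConvexBornology V R} {M : Submodule V R} :
    specRadius π ε B M ≤ 1 ↔ ∀ r : ℝ, 1 < r → B.Bdd (powerSum π ε r M : Set R) := by
  constructor
  · intro h r hr
    have h1 : specRadius π ε B M < ENNReal.ofReal r :=
      h.trans_lt (by rw [← ENNReal.ofReal_one]; exact (ENNReal.ofReal_lt_ofReal_iff
        (by linarith)).2 hr)
    obtain ⟨_, ⟨s, hs1, hs, rfl⟩, hsr⟩ := sInf_lt_iff.1 h1
    have hsr' : s ≤ r := ((ENNReal.ofReal_lt_ofReal_iff (by linarith)).1 hsr).le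
    refine hs.subset (SetLike.coe_subset_coe.2 (iSup_mono fun n => ?_))
    have hs0 : 0 < s := by linarith
    have hr0 : 0 < r := by linarith
    refine star_mono hε0 hε1 (by positivity) ?_ _
    gcongr
  · intro h
    refine le_of_forall_gt fun b hb => ?_
    obtain ⟨q, hq1, hqb⟩ := ENNReal.lt_iff_exists_nnreal_btwn.1 hb
    refine lt_of_le_of_lt (sInf_le ⟨q, ?_, h q ?_, rfl⟩) (by simpa using hqb)
    · exact_mod_cast hq1.le
    · exact_mod_cast hq1

theorem linearGrowth_isGrowthBornology {π : V} {ε : ℝ} (hε0 : 0 < ε) (hε1 : ε < 1)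
    (B : ConvexBornology V R) : IsGrowthBornology π ε B (linearGrowth π ε B) := by
  refine ⟨fun S T hS hT => ?_, fun S hS => ?_, fun M hM => ?_⟩
  · exact bdd_linearGrowth.2 fun B' hB' =>
      hB'.1 S T (linearGrowth_le hB' hS) (linearGrowth_le hB' hT)
  · exact bdd_linearGrowth.2 fun B' hB' => hB'.2.1 S hS
  · exact (specRadius_le_one_iff hε0 hε1).2 fun r hr => bdd_linearGrowth.2 fun B' hB' =>
      (specRadius_le_one_iff hε0 hε1).1 (hB'.2.2 M (linearGrowth_le hB' hM)) r hr

end Algebras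

/-! ### The Monsky–Washnitzer weak completion -/

section Dagger

variable {V : Type*} [CommRing V] (π : V) (R : Type*) [CommRing R] [Algebra V R]

/-- The `π`-adic completion of `R`, the projective limit of the rings `R / π ^ j R`. -/
abbrev PiAdic : Type _ := AdicCompletion (Ideal.span {algebraMap V R π}) R

variable {R}

/-- `z = ∑ⱼ π ^ j wⱼ` in the `π`-adic completion: for all `n`, the partial sum over `j < n` (the
other summands vanish modulo `π ^ n`) represents the image of `z` in `R / π ^ n R`. -/
def IsPiSum (z : PiAdic π R) (w : ℕ → R) : Prop :=
  ∀ n : ℕ, AdicCompletion.evalₐ (Ideal.span {algebraMap V R π}) n z =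
    Ideal.Quotient.mk _ (∑ j ∈ Finset.range n, π ^ j • w j)

/-- The elements `∑ⱼ π ^ j wⱼ` with `wⱼ ∈ M ^ κⱼ` and `κⱼ ≤ c (j + 1)`. -/
def daggerSet (M : Submodule V R) (c : ℝ) : Set (PiAdic π R) :=
  {z | ∃ (w : ℕ → R) (κ : ℕ → ℕ), (∀ j, w j ∈ M ^ κ j) ∧ (∀ j, (κ j : ℝ) ≤ c * (j + 1)) ∧
    IsPiSum π z w}

variable {π}

theorem fg_one : (1 : Submodule V R).FG := by
  rw [Submodule.one_eq_span]
  exact Submodule.fg_span_singleton 1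

theorem daggerSet_mono {M M' : Submodule V R} (hM : M ≤ M') {c c' : ℝ} (hc : c ≤ c') :
    daggerSet π M c ⊆ daggerSet π M' c' := by
  rintro z ⟨w, κ, hw, hκ, hz⟩
  refine ⟨w, κ, fun j => pow_le_pow_left' hM _ (hw j), fun j => (hκ j).trans ?_, hz⟩
  gcongr

theorem pow_le_pow_of_one_mem {M : Submodule V R} (hM : (1 : R) ∈ M) {a b : ℕ} (h : a ≤ b) :
    M ^ a ≤ M ^ b :=
  pow_le_pow_right₀ (Submodule.one_le.2 hM) h

theorem add_mem_daggerSet {M : Submodule V R} (hM : (1 : R) ∈ M) {c : ℝ} {x y : PiAdic π R}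
    (hx : x ∈ daggerSet π M c) (hy : y ∈ daggerSet π M c) : x + y ∈ daggerSet π M c := by
  obtain ⟨w, κ, hw, hκ, hz⟩ := hx
  obtain ⟨w', κ', hw', hκ', hz'⟩ := hy
  refine ⟨w + w', fun j => max (κ j) (κ' j), fun j => add_mem ?_ ?_, fun j => ?_, fun n => ?_⟩
  · exact pow_le_pow_of_one_mem hM (le_max_left _ _) (hw j)
  · exact pow_le_pow_of_one_mem hM (le_max_right _ _) (hw' j)
  · push_cast
    exact max_le (hκ j) (hκ' j)
  · rw [map_add, hz n, hz' n, ← map_add, ← Finset.sum_add_distrib]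
    simp only [Pi.add_apply, smul_add]

theorem algebraMap_mem_daggerSet (M : Submodule V R) {c : ℝ} (hc : 0 < c) (v : V) :
    algebraMap V (PiAdic π R) v ∈ daggerSet π M c := by
  refine ⟨fun j => if j = 0 then algebraMap V R v else 0, fun _ => 0, fun j => ?_,
    fun j => ?_, fun n => ?_⟩
  · dsimp only
    split_ifs
    · rw [pow_zero]; exact Submodule.algebraMap_mem v
    · exact zero_mem _
  · push_cast; positivity
  · rw [AdicCompletion.algebraMap_apply, AdicCompletion.evalₐ_of]
    rcases n with _ | n
    · rw [Ideal.Quotient.eq]; simp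
    · rw [Finset.sum_range_succ']; simp

theorem smul_mem_daggerSet {M : Submodule V R} {c : ℝ} (a : V) {x : PiAdic π R}
    (hx : x ∈ daggerSet π M c) : a • x ∈ daggerSet π M c := by
  obtain ⟨w, κ, hw, hκ, hz⟩ := hx
  refine ⟨fun j => a • w j, κ, fun j => Submodule.smul_mem _ a (hw j), hκ, fun n => ?_⟩
  rw [Algebra.smul_def, AdicCompletion.algebraMap_apply, map_mul, AdicCompletion.evalₐ_of, hz n,
    ← map_mul, ← Algebra.smul_def, Finset.smul_sum]
  simp only [smul_comm a]

theorem of_mem_daggerSet (r : R) :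
    algebraMap R (PiAdic π R) r ∈ daggerSet π (Submodule.span V {1, r}) 1 := by
  refine ⟨fun j => if j = 0 then r else 0, fun j => if j = 0 then 1 else 0, fun j => ?_,
    fun j => ?_, fun n => ?_⟩
  · dsimp only
    split_ifs
    · rw [pow_one]; exact Submodule.subset_span (by simp)
    · exact zero_mem _
  · dsimp only
    split_ifs with h
    · simp [h]
    · push_cast; positivity
  · rw [AdicCompletion.algebraMap_apply, AdicCompletion.evalₐ_of]
    rcases n with _ | n
    · rw [Ideal.Quotient.eq]; simp
    · rw [Finset.sum_range_succ']; simp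

theorem mul_mem_daggerSet {M M' : Submodule V R} {c c' : ℝ}
    (hM : (1 : R) ∈ M) (hM' : (1 : R) ∈ M') (hc : 0 < c) (hc' : 0 < c')
    {x y : PiAdic π R} (hx : x ∈ daggerSet π M c) (hy : y ∈ daggerSet π M' c') :
    x * y ∈ daggerSet π (M ⊔ M') (c + c') := by
  obtain ⟨w, κ, hw, hκ, hz⟩ := hx
  obtain ⟨w', κ', hw', hκ', hz'⟩ := hy
  have h1 : (1 : R) ∈ M ⊔ M' := le_sup_left (a := M) hM
  refine ⟨fun n => ∑ p ∈ Finset.HasAntidiagonal.antidiagonal n, w p.1 * w' p.2,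
    fun n => ⌊(c + c') * ((n : ℝ) + 1)⌋₊, fun n => ?_, fun n => ?_, fun n => ?_⟩
  · refine Submodule.sum_mem _ fun p hp => ?_
    rw [Finset.HasAntidiagonal.mem_antidiagonal] at hp
    refine pow_le_pow_of_one_mem h1 (a := κ p.1 + κ' p.2) ?_ ?_
    · refine Nat.le_floor ?_
      have e1 := hκ p.1
      have e2 := hκ' p.2
      have e3 : (p.1 : ℝ) ≤ n := by exact_mod_cast (by omega : p.1 ≤ n)
      have e4 : (p.2 : ℝ) ≤ n := by exact_mod_cast (by omega : p.2 ≤ n)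
      push_cast
      nlinarith
    · rw [pow_add]
      exact Submodule.mul_mem_mul (pow_le_pow_left' (le_sup_left : M ≤ M ⊔ M') _ (hw _))
        (pow_le_pow_left' (le_sup_right : M' ≤ M ⊔ M') _ (hw' _))
  · exact Nat.floor_le (by positivity)
  · rw [map_mul, hz n, hz' n, ← map_mul, Ideal.Quotient.eq]
    have key : (∑ j ∈ Finset.range n, π ^ j • w j) * (∑ j ∈ Finset.range n, π ^ j • w' j) -
        ∑ j ∈ Finset.range n, π ^ j • ∑ p ∈ Finset.HasAntidiagonal.antidiagonal j,
          w p.1 * w' p.2 =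
        ∑ p ∈ (Finset.range n ×ˢ Finset.range n).filter (fun p => ¬ p.1 + p.2 < n),
          (π ^ p.1 • w p.1) * (π ^ p.2 • w' p.2) := by
      rw [Finset.sum_mul_sum, ← Finset.sum_product', sub_eq_iff_eq_add,
        ← Finset.sum_filter_not_add_sum_filter _ (fun p : ℕ × ℕ => p.1 + p.2 < n)]
      congr 1
      rw [← Finset.sum_fiberwise_of_maps_to (t := Finset.range n) (g := fun p : ℕ × ℕ => p.1 + p.2)
        (fun p hp => Finset.mem_range.2 (Finset.mem_filter.1 hp).2)]
      refine Finset.sum_congr rfl fun k hk => ?_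
      rw [Finset.smul_sum]
      refine Finset.sum_congr ?_ fun p hp => ?_
      · ext p
        simp only [Finset.mem_filter, Finset.mem_product, Finset.mem_range,
          Finset.HasAntidiagonal.mem_antidiagonal] at hk ⊢
        omega
      · rw [Finset.HasAntidiagonal.mem_antidiagonal] at hp
        rw [smul_mul_smul_comm, ← pow_add, hp]
    rw [key]
    refine Ideal.sum_mem _ fun p hp => ?_
    have hp' : n ≤ p.1 + p.2 := not_lt.1 (Finset.mem_filter.1 hp).2
    rw [smul_mul_smul_comm, ← pow_add, Algebra.smul_def, map_pow, Ideal.span_singleton_pow]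
    exact Ideal.mul_mem_right _ _ (Ideal.mem_span_singleton.2 (pow_dvd_pow _ hp'))

variable (π R)

/-- The weak completion `R†`, a subalgebra of the `π`-adic completion of `R`. -/
noncomputable def dagger : Subalgebra V (PiAdic π R) where
  carrier := {z | ∃ (M : Submodule V R) (c : ℝ), M.FG ∧ (1 : R) ∈ M ∧ 0 < c ∧ z ∈ daggerSet π M c}
  mul_mem' := by
    rintro x y ⟨M, c, hM, h1, hc, hx⟩ ⟨M', c', hM', h1', hc', hy⟩
    exact ⟨M ⊔ M', c + c', hM.sup hM', le_sup_left (a := M) h1, by positivity,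
      mul_mem_daggerSet h1 h1' hc hc' hx hy⟩
  add_mem' := by
    rintro x y ⟨M, c, hM, h1, hc, hx⟩ ⟨M', c', hM', h1', hc', hy⟩
    exact ⟨M ⊔ M', max c c', hM.sup hM', le_sup_left (a := M) h1, lt_max_of_lt_left hc,
      add_mem_daggerSet (le_sup_left (a := M) h1)
        (daggerSet_mono le_sup_left (le_max_left _ _) hx)
        (daggerSet_mono le_sup_right (le_max_right _ _) hy)⟩
  algebraMap_mem' v := ⟨1, 1, fg_one, Submodule.one_le.1 le_rfl, one_pos,
    algebraMap_mem_daggerSet _ one_pos v⟩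

/-- The bornology of `R†`: a subset is bounded if all its elements are of the form
`∑ⱼ π ^ j wⱼ` with `wⱼ ∈ M ^ κⱼ`, `κⱼ ≤ c (j + 1)`, for a fixed finitely generated submodule `M`
containing `1` and a fixed `c > 0`. -/
noncomputable def daggerBornology : ConvexBornology V (dagger π R) :=
  ConvexBornology.ofBdd
    {S | ∃ (M : Submodule V R) (c : ℝ), M.FG ∧ (1 : R) ∈ M ∧ 0 < c ∧
      ∀ z ∈ S, (z : PiAdic π R) ∈ daggerSet π M c}
    ⟨1, 1, fg_one, Submodule.one_le.1 le_rfl, one_pos, fun _ h => h.elim⟩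
    (fun _ ⟨M, c, hM, h1, hc, h⟩ _ ht => ⟨M, c, hM, h1, hc, fun z hz => h z (ht hz)⟩)
    (by
      rintro S ⟨M, c, hM, h1, hc, h⟩ T ⟨M', c', hM', h1', hc', h'⟩
      refine ⟨M ⊔ M', max c c', hM.sup hM', le_sup_left (a := M) h1, lt_max_of_lt_left hc, ?_⟩
      rintro z (hz | hz)
      · exact daggerSet_mono le_sup_left (le_max_left _ _) (h z hz)
      · exact daggerSet_mono le_sup_right (le_max_right _ _) (h' z hz))
    (by
      rintro ⟨x, M, c, hM, h1, hc, h⟩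
      refine ⟨M, c, hM, h1, hc, ?_⟩
      rintro z rfl
      exact h)
    (by
      rintro S ⟨M, c, hM, h1, hc, h⟩
      refine ⟨M, c, hM, h1, hc, fun z hz => ?_⟩
      induction hz using Submodule.span_induction with
      | mem x hx => exact h x hx
      | zero => simpa using algebraMap_mem_daggerSet (π := π) M hc 0
      | add x y _ _ hx hy => exact add_mem_daggerSet h1 hx hy
      | smul a x _ hx => exact smul_mem_daggerSet a hx)

/-- The canonical homomorphism `R → R†`. -/
noncomputable def toDagger : R →ₐ[V] dagger π R :=
  (IsScalarTower.toAlgHom V R (PiAdic π R)).codRestrict (dagger π R) (fun r =>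
    ⟨Submodule.span V {1, r}, 1, Submodule.fg_span (Set.toFinite _),
      Submodule.subset_span (by simp), one_pos, of_mem_daggerSet r⟩)

end Dagger

end MW

universe t v u

/-! A bounded linear map `f` from `R` to a complete `Y` can only extend to `R†` by sending `∑ π ^ j
wⱼ` to the limit of `f` on the partial sums, because every element of `R†` is the bornological limit
of such sums (`dagger_hom_ext`). The proof shows that this recipe works.

The limits exist: the terms `π ^ j wⱼ` lie in a submodule `∑ⱼ π ^ j M ^ ⌊c (j + 1)⌋`, which is
bounded for linear growth (`bdd_linSum`). Writing `π ^ n = π ^ (n / 2) π ^ (n - n / 2)`, the first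
factor gives the rate of convergence, while the second keeps the tails in one such submodule at the
price of doubling `c`.

The limit must not depend on the series, so a series of linear growth with sum `0` in the `π`-adic
completion needs partial sums that converge to `0` in `R` (`bornConverges_partialSum_zero`). Its
`n`-th partial sum lies in `π ^ n R ∩ M ^ a` with `a` linear in `n`, and has to be shown to lie in
`π ^ n M ^ b` with `b` still linear in `n`. This uniform Artin–Rees statement,
`exists_forall_mem_pow_smul`, is the heart of the proof. It comes from noetherianity of a bigraded
Rees algebra and allows `π`-torsion in `R`.

In the other direction, the bornology pulled back from `R†` to `R` is admissible
(`isGrowthBornology_comap_toDagger`), so minimality of linear growth makes `R → R†` bounded.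
Completeness of `R†` follows by resumming telescoping series. The comparison with another completion
`C` is formal: multiplicativity is an identity of bounded linear maps that can be checked on `R`. -/

namespace MW

/-! ### Uniform Artin–Rees estimate from a bigraded Rees algebra -/

section Rees

variable {V : Type*} [CommRing V] {R : Type*} [CommRing R] [Algebra V R]

open Polynomial in
/-- The bigraded Rees algebra `⨁ M ^ d hᵈ Tⁱ` of the filtration of `R` by the powers of `M`,
with an additional polynomial variable `T`. -/
noncomputable def reesSubalgebra (M : Submodule V R) : Subalgebra V R[X][X] where
  carrier := {p | ∀ i d, (p.coeff i).coeff d ∈ M ^ d}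
  mul_mem' := by
    intro a b ha hb i d
    rw [coeff_mul, finsetSum_coeff]
    refine Submodule.sum_mem _ fun x _ => ?_
    rw [coeff_mul]
    refine Submodule.sum_mem _ fun y hy => ?_
    rw [← Finset.HasAntidiagonal.mem_antidiagonal.1 hy, pow_add]
    exact Submodule.mul_mem_mul (ha _ _) (hb _ _)
  add_mem' := by
    intro a b ha hb i d
    rw [coeff_add, coeff_add]
    exact add_mem (ha i d) (hb i d)
  algebraMap_mem' := by
    intro v i d
    rw [Polynomial.algebraMap_apply, Polynomial.algebraMap_apply, coeff_C]
    split_ifs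
    · rw [coeff_C]
      split_ifs with h
      · subst h
        rw [pow_zero]
        exact Submodule.algebraMap_mem v
      · exact zero_mem _
    · rw [coeff_zero]
      exact zero_mem _

-- This gives finite generation of the Rees algebra: its homogeneous elements are polynomials over
-- `V` in `T` and the degree-one elements `m h` with `m ∈ s`, so Hilbert's basis theorem applies
-- when `s` is finite.
open Polynomial in
theorem monomial_mem_adjoin (s : Set R) (d i : ℕ) {a : R} (ha : a ∈ Submodule.span V s ^ d) :
    monomial i (monomial d a) ∈
      Algebra.adjoin V (insert (X : R[X][X]) ((fun m => C (monomial 1 m)) '' s)) := by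
  have hX : (X : R[X][X]) ∈
      Algebra.adjoin V (insert (X : R[X][X]) ((fun m => C (monomial 1 m)) '' s)) :=
    Algebra.subset_adjoin (Set.mem_insert _ _)
  have h1 : ∀ m ∈ Submodule.span V s, C (monomial 1 m) ∈
      Algebra.adjoin V (insert (X : R[X][X]) ((fun m => C (monomial 1 m)) '' s)) := by
    intro m hm
    induction hm using Submodule.span_induction with
    | mem x hx => exact Algebra.subset_adjoin (Set.mem_insert_of_mem _ ⟨x, hx, rfl⟩)
    | zero => simp
    | add x y _ _ hx hy => simpa using add_mem hx hy
    | smul v x _ hx =>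
      have := Subalgebra.smul_mem _ hx v
      rwa [Polynomial.smul_C, Polynomial.smul_monomial] at this
  have h2 : C (monomial d a) ∈
      Algebra.adjoin V (insert (X : R[X][X]) ((fun m => C (monomial 1 m)) '' s)) := by
    induction ha using Submodule.pow_induction_on_left' with
    | algebraMap r =>
      exact Subalgebra.algebraMap_mem _ r
    | add x y i _ _ hx hy => simpa using add_mem hx hy
    | mem_mul m hm i x _ hx =>
      have := mul_mem (h1 m hm) hx
      rwa [← C_mul, monomial_mul_monomial, add_comm] at this
  have := mul_mem h2 (pow_mem hX i)
  rwa [C_mul_X_pow_eq_monomial] at this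

open Polynomial in
/-- In a noetherian filtered algebra, divisibility by `π` of elements `π ^ i s` costs only a
bounded amount of filtration degree. -/
theorem exists_forall_smul_mem_pow_succ [IsNoetherianRing V] (π : V) {M : Submodule V R}
    (hM : M.FG) (h1 : (1 : R) ∈ M) (hgen : ∀ r : R, ∃ m : ℕ, r ∈ M ^ m) :
    ∃ k : ℕ, ∀ (i d : ℕ) (s r : R), s ∈ M ^ d → π ^ i • s = π ^ (i + 1) • r →
      π ^ i • s ∈ π ^ (i + 1) • M ^ (d + k) := by
  classical
  obtain ⟨t, rfl⟩ := hM
  set M : Submodule V R := Submodule.span V (t : Set R) with hMdef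
  set A := Algebra.adjoin V (insert (X : R[X][X]) ((fun m => C (monomial 1 m)) '' (t : Set R)))
    with hA
  have hAle : A ≤ reesSubalgebra M := by
    refine Algebra.adjoin_le ?_
    rintro _ (rfl | ⟨m, hm, rfl⟩) i d
    · rw [coeff_X]
      split_ifs
      · rw [coeff_one]
        split_ifs with h
        · exact pow_le_pow_of_one_mem h1 (Nat.zero_le _)
            (by rw [pow_zero]; exact Submodule.one_le.1 le_rfl)
        · exact zero_mem _
      · rw [coeff_zero]
        exact zero_mem _
    · rw [coeff_C]
      split_ifs
      · rw [coeff_monomial]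
        split_ifs with h
        · subst h
          rw [pow_one]
          exact Submodule.subset_span hm
        · exact zero_mem _
      · rw [coeff_zero]
        exact zero_mem _
  have hN : IsNoetherianRing A := by
    have : (insert (X : R[X][X]) ((fun m => C (monomial 1 m)) '' (t : Set R))) =
        ((insert (X : R[X][X]) (t.image (fun m => C (monomial 1 m))) : Finset R[X][X]) :
          Set R[X][X]) := by simp
    rw [hA, this]
    exact isNoetherianRing_of_fg (Subalgebra.fg_adjoin_finset _)
  -- `I k` collects the elements whose coefficients are divisible by one more `π` at a cost of `k`
  -- filtration degrees. The variable `T` records the exponent `i`, so that stabilization of this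
  -- chain yields one `k` for all `i` and `d`.
  let I : ℕ →o Ideal A :=
    { toFun := fun k =>
        { carrier := {p | ∀ i d, π ^ i • ((p : R[X][X]).coeff i).coeff d ∈
            π ^ (i + 1) • M ^ (d + k)}
          zero_mem' := fun i d => by simp
          add_mem' := fun {a b} ha hb i d => by
            simpa using add_mem (ha i d) (hb i d)
          smul_mem' := fun a b hb i d => by
            rw [smul_eq_mul, MulMemClass.coe_mul, coeff_mul, finsetSum_coeff, Finset.smul_sum]
            refine Submodule.sum_mem _ fun x hx => ?_
            rw [coeff_mul, Finset.smul_sum]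
            refine Submodule.sum_mem _ fun y hy => ?_
            obtain ⟨z, hz, hz'⟩ := hb x.2 y.2
            have ha := hAle a.2 x.1 y.1
            have hz' : π ^ (x.2 + 1) • z = π ^ x.2 • ((b : R[X][X]).coeff x.2).coeff y.2 := hz'
            refine ⟨((a : R[X][X]).coeff x.1).coeff y.1 * z, ?_, ?_⟩
            · rw [← Finset.HasAntidiagonal.mem_antidiagonal.1 hy, add_assoc, pow_add]
              exact Submodule.mul_mem_mul ha hz
            · change π ^ (i + 1) • (((a : R[X][X]).coeff x.1).coeff y.1 * z) = _
              rw [← Finset.HasAntidiagonal.mem_antidiagonal.1 hx, add_assoc, pow_add,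
                mul_smul, ← mul_smul_comm (π ^ (x.2 + 1)), hz', mul_smul_comm, ← mul_smul, ← pow_add] }
      monotone' := fun k l hkl p hp i d => by
        obtain ⟨z, hz, hz'⟩ := hp i d
        exact ⟨z, pow_le_pow_of_one_mem h1 (by omega) hz, hz'⟩ }
  obtain ⟨k, hk⟩ := monotone_stabilizes_iff_noetherian.2 hN I
  refine ⟨k, fun i d s r hs hr => ?_⟩
  obtain ⟨m, hm⟩ := hgen r
  let p : A := ⟨monomial i (monomial d s), monomial_mem_adjoin _ _ _ hs⟩
  -- The witness `r` lies in some `M ^ m`, with `m` depending on `r`; stabilization of the chain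
  -- then replaces `max k m` by `k`.
  have hp : p ∈ I (max k m) := fun i' d' => by
    simp only [p, coeff_monomial]
    split_ifs with h
    · subst h
      rw [coeff_monomial]
      split_ifs with h
      · subst h
        rw [hr]
        exact ⟨r, pow_le_pow_of_one_mem h1 (by omega) hm, rfl⟩
      · simp
    · simp
  rw [← hk _ (le_max_left k m)] at hp
  simpa [p] using hp i d

/-- An element of `M ^ d` that is divisible by `π ^ n` in `R` is divisible by `π ^ n` in
`M ^ (d + k n)`, for a fixed `k`. -/
theorem exists_forall_mem_pow_smul [IsNoetherianRing V] (π : V) {M : Submodule V R}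
    (hM : M.FG) (h1 : (1 : R) ∈ M) (hgen : ∀ r : R, ∃ m : ℕ, r ∈ M ^ m) :
    ∃ k : ℕ, ∀ (n d : ℕ) (r : R), π ^ n • r ∈ M ^ d → π ^ n • r ∈ π ^ n • M ^ (d + k * n) := by
  obtain ⟨k, hk⟩ := exists_forall_smul_mem_pow_succ π hM h1 hgen
  refine ⟨k, fun n d r hr => ?_⟩
  -- The factors `π` are extracted one at a time: if `π ^ n r = π ^ i s`, this is also `π ^ (i + 1)`
  -- times `π ^ (n - (i + 1)) r`, so the previous lemma gives another factor at a cost of `k`.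
  suffices h : ∀ i ≤ n, π ^ n • r ∈ π ^ i • M ^ (d + k * i) from h n le_rfl
  intro i
  induction i with
  | zero => exact fun _ => ⟨_, by simpa using hr, by simp⟩
  | succ i ih =>
    intro hi
    obtain ⟨s, hs, hs'⟩ := ih (by omega)
    have hs' : π ^ i • s = π ^ n • r := hs'
    have := hk i _ s (π ^ (n - (i + 1)) • r) hs
      (by rw [hs', smul_smul, ← pow_add]; congr 2; omega)
    rwa [hs', add_assoc, ← Nat.mul_succ] at this

end Rees

/-! ### Calculus of `π`-adic series and filtrations of linear growth -/

section Series

variable {V : Type*} [CommRing V] {π : V} {R : Type*} [CommRing R] [Algebra V R]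

/-- The partial sums of the series `∑ⱼ π ^ j wⱼ`. -/
def partialSum (π : V) (w : ℕ → R) (n : ℕ) : R :=
  ∑ j ∈ Finset.range n, π ^ j • w j

theorem partialSum_add_index (w : ℕ → R) (m n : ℕ) :
    partialSum π w (m + n) = partialSum π w m + π ^ m • partialSum π (fun j => w (m + j)) n := by
  simp only [partialSum, Finset.sum_range_add, Finset.smul_sum, pow_add, mul_smul]

theorem partialSum_add (w w' : ℕ → R) (n : ℕ) :
    partialSum π (w + w') n = partialSum π w n + partialSum π w' n := by
  simp only [partialSum, Pi.add_apply, smul_add, Finset.sum_add_distrib]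

theorem partialSum_smul (a : V) (w : ℕ → R) (n : ℕ) :
    partialSum π (a • w) n = a • partialSum π w n := by
  simp only [partialSum, Pi.smul_apply, smul_comm _ a, Finset.smul_sum]

theorem isPiSum_iff {z : PiAdic π R} {w : ℕ → R} : IsPiSum π z w ↔
    ∀ n : ℕ, AdicCompletion.evalₐ (Ideal.span {algebraMap V R π}) n z =
      Ideal.Quotient.mk _ (partialSum π w n) := Iff.rfl

theorem pow_smul_mem_span_pow {m n : ℕ} (h : m ≤ n) (x : R) :
    π ^ n • x ∈ Ideal.span {algebraMap V R π} ^ m := by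
  rw [Algebra.smul_def, map_pow, Ideal.span_singleton_pow]
  exact Ideal.mul_mem_right _ _ (Ideal.mem_span_singleton.2 (pow_dvd_pow _ h))

theorem exists_pow_smul_eq {n : ℕ} {x : R} (h : x ∈ Ideal.span {algebraMap V R π} ^ n) :
    ∃ y : R, π ^ n • y = x := by
  rw [Ideal.span_singleton_pow, Ideal.mem_span_singleton] at h
  obtain ⟨y, rfl⟩ := h
  exact ⟨y, by rw [Algebra.smul_def, map_pow]⟩

theorem mk_pow_smul {m n : ℕ} (h : m ≤ n) (x : R) :
    Ideal.Quotient.mk (Ideal.span {algebraMap V R π} ^ m) (π ^ n • x) = 0 :=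
  Ideal.Quotient.eq_zero_iff_mem.2 (pow_smul_mem_span_pow h x)

theorem mk_partialSum {m n : ℕ} (h : m ≤ n) (w : ℕ → R) :
    Ideal.Quotient.mk (Ideal.span {algebraMap V R π} ^ m) (partialSum π w n) =
      Ideal.Quotient.mk _ (partialSum π w m) := by
  obtain ⟨k, rfl⟩ := Nat.exists_eq_add_of_le h
  rw [partialSum_add_index, map_add, mk_pow_smul le_rfl, add_zero]

theorem evalₐ_smul (n : ℕ) (a : V) (z : PiAdic π R) :
    AdicCompletion.evalₐ (Ideal.span {algebraMap V R π}) n (a • z) =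
      a • AdicCompletion.evalₐ (Ideal.span {algebraMap V R π}) n z := by
  rw [Algebra.smul_def, AdicCompletion.algebraMap_apply, map_mul, AdicCompletion.evalₐ_of,
    Algebra.smul_def]
  rfl

theorem mk_smul' (n : ℕ) (a : V) (x : R) :
    Ideal.Quotient.mk (Ideal.span {algebraMap V R π} ^ n) (a • x) =
      a • Ideal.Quotient.mk (Ideal.span {algebraMap V R π} ^ n) x := by
  rw [Algebra.smul_def, map_mul, Algebra.smul_def]
  rfl

theorem evalₐ_algebraMap (n : ℕ) (r : R) :
    AdicCompletion.evalₐ (Ideal.span {algebraMap V R π}) n (algebraMap R (PiAdic π R) r) =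
      Ideal.Quotient.mk _ r := by
  rw [AdicCompletion.algebraMap_apply, AdicCompletion.evalₐ_of]
  rfl

theorem exists_isPiSum (π : V) (w : ℕ → R) : ∃ z : PiAdic π R, IsPiSum π z w := by
  have h : ∀ n, partialSum π w n ≡ partialSum π w (n + 1)
      [SMOD (Ideal.span {algebraMap V R π} ^ n • ⊤ : Submodule R R)] := fun n => by
    rw [SModEq.sub_mem, smul_eq_mul, Ideal.mul_top, ← Ideal.Quotient.eq]
    exact (mk_partialSum (Nat.le_succ n) w).symm
  exact ⟨AdicCompletion.mk _ R (AdicCompletion.AdicCauchySequence.mk _ R _ h),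
    fun n => AdicCompletion.evalₐ_mk _ _ _⟩

theorem IsPiSum.unique {z z' : PiAdic π R} {w : ℕ → R} (h : IsPiSum π z w)
    (h' : IsPiSum π z' w) : z = z' :=
  AdicCompletion.ext_evalₐ fun n => (h n).trans (h' n).symm

theorem IsPiSum.add {z z' : PiAdic π R} {w w' : ℕ → R} (h : IsPiSum π z w)
    (h' : IsPiSum π z' w') : IsPiSum π (z + z') (w + w') := by
  rw [isPiSum_iff] at *
  intro n
  rw [map_add, h, h', partialSum_add, map_add]

theorem IsPiSum.smul {z : PiAdic π R} {w : ℕ → R} (a : V) (h : IsPiSum π z w) :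
    IsPiSum π (a • z) (a • w) := by
  rw [isPiSum_iff] at *
  intro n
  rw [evalₐ_smul, h, partialSum_smul, mk_smul']

theorem isPiSum_zero : IsPiSum π (0 : PiAdic π R) 0 := by
  intro n
  simp

theorem isPiSum_algebraMap (r : R) :
    IsPiSum π (algebraMap R (PiAdic π R) r) (fun j => if j = 0 then r else 0) := by
  intro n
  rw [evalₐ_algebraMap]
  rcases n with _ | n
  · rw [Ideal.Quotient.eq]; simp
  · rw [Finset.sum_range_succ']; simp

theorem IsPiSum.pow_smul {z : PiAdic π R} {w : ℕ → R} (h : IsPiSum π z w) (n : ℕ) {w' : ℕ → R}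
    (h0 : ∀ j < n, w' j = 0) (h1 : ∀ j, w' (n + j) = w j) : IsPiSum π (π ^ n • z) w' := by
  rw [isPiSum_iff] at *
  intro m
  -- Modulo `π ^ m` the partial sum of `w'` may be taken up to `n + m`, where it splits into `n`
  -- vanishing terms and `π ^ n` times a partial sum of `w`.
  rw [evalₐ_smul, h, ← mk_partialSum (Nat.le_add_left m n) w', partialSum_add_index, funext h1,
    ← mk_smul']
  congr 1
  rw [right_eq_add]
  exact Finset.sum_eq_zero fun j hj => by rw [h0 j (Finset.mem_range.1 hj), smul_zero]

theorem IsPiSum.eq_add {z z' : PiAdic π R} {w : ℕ → R} (h : IsPiSum π z w) (n : ℕ)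
    (h' : IsPiSum π z' (fun j => w (n + j))) :
    z = algebraMap R (PiAdic π R) (partialSum π w n) + π ^ n • z' := by
  rw [isPiSum_iff] at *
  refine AdicCompletion.ext_evalₐ fun m => ?_
  rw [map_add, evalₐ_smul, h, h', evalₐ_algebraMap, ← mk_smul', ← map_add, ← partialSum_add_index,
    mk_partialSum (Nat.le_add_left m n)]

/-- The product of two partial sums differs from the truncated Cauchy product only in terms of total
index at least `n`, and these vanish modulo `π ^ n`. -/
theorem IsPiSum.mul {z z' : PiAdic π R} {w w' : ℕ → R} (hz : IsPiSum π z w)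
    (hz' : IsPiSum π z' w') : IsPiSum π (z * z')
      (fun n => ∑ p ∈ Finset.HasAntidiagonal.antidiagonal n, w p.1 * w' p.2) := by
  intro n
  rw [map_mul, hz n, hz' n, ← map_mul, Ideal.Quotient.eq]
  have key : (∑ j ∈ Finset.range n, π ^ j • w j) * (∑ j ∈ Finset.range n, π ^ j • w' j) -
      ∑ j ∈ Finset.range n, π ^ j • ∑ p ∈ Finset.HasAntidiagonal.antidiagonal j,
        w p.1 * w' p.2 =
      ∑ p ∈ (Finset.range n ×ˢ Finset.range n).filter (fun p => ¬ p.1 + p.2 < n),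
        (π ^ p.1 • w p.1) * (π ^ p.2 • w' p.2) := by
    rw [Finset.sum_mul_sum, ← Finset.sum_product', sub_eq_iff_eq_add,
      ← Finset.sum_filter_not_add_sum_filter _ (fun p : ℕ × ℕ => p.1 + p.2 < n)]
    congr 1
    rw [← Finset.sum_fiberwise_of_maps_to (t := Finset.range n) (g := fun p : ℕ × ℕ => p.1 + p.2)
      (fun p hp => Finset.mem_range.2 (Finset.mem_filter.1 hp).2)]
    refine Finset.sum_congr rfl fun k hk => ?_
    rw [Finset.smul_sum]
    refine Finset.sum_congr ?_ fun p hp => ?_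
    · ext p
      simp only [Finset.mem_filter, Finset.mem_product, Finset.mem_range,
        Finset.HasAntidiagonal.mem_antidiagonal] at hk ⊢
      omega
    · rw [Finset.HasAntidiagonal.mem_antidiagonal] at hp
      rw [smul_mul_smul_comm, ← pow_add, hp]
  rw [key]
  refine Ideal.sum_mem _ fun p hp => ?_
  rw [smul_mul_smul_comm, ← pow_add]
  exact pow_smul_mem_span_pow (not_lt.1 (Finset.mem_filter.1 hp).2) _

variable (π) in
/-- The sums `∑ⱼ π ^ j wⱼ` with `wⱼ ∈ F j`. -/
def seriesSubmodule (F : ℕ → Submodule V R) : Submodule V (PiAdic π R) where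
  carrier := {z | ∃ w : ℕ → R, (∀ j, w j ∈ F j) ∧ IsPiSum π z w}
  zero_mem' := ⟨0, fun j => zero_mem _, isPiSum_zero⟩
  add_mem' := by
    rintro x y ⟨w, hw, hx⟩ ⟨w', hw', hy⟩
    exact ⟨w + w', fun j => add_mem (hw j) (hw' j), hx.add hy⟩
  smul_mem' := by
    rintro a x ⟨w, hw, hx⟩
    exact ⟨a • w, fun j => Submodule.smul_mem _ a (hw j), hx.smul a⟩

theorem pow_smul_mem_seriesSubmodule {F F' : ℕ → Submodule V R} (n : ℕ)
    (h : ∀ j, F j ≤ F' (n + j)) {z : PiAdic π R} (hz : z ∈ seriesSubmodule π F) :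
    π ^ n • z ∈ seriesSubmodule π F' := by
  obtain ⟨w, hw, hz⟩ := hz
  refine ⟨fun j => if j < n then 0 else w (j - n), fun j => ?_, hz.pow_smul n ?_ ?_⟩
  · dsimp only
    split_ifs with hj
    · exact zero_mem _
    · have := h (j - n) (hw _)
      rwa [Nat.add_sub_cancel' (not_lt.1 hj)] at this
  · intro j hj
    exact if_pos hj
  · intro j
    rw [if_neg (by omega), Nat.add_sub_cancel_left]

theorem mul_mem_seriesSubmodule {F F' F'' : ℕ → Submodule V R}
    (h : ∀ i j, F i * F' j ≤ F'' (i + j)) {z z' : PiAdic π R} (hz : z ∈ seriesSubmodule π F)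
    (hz' : z' ∈ seriesSubmodule π F') : z * z' ∈ seriesSubmodule π F'' := by
  obtain ⟨w, hw, hz⟩ := hz
  obtain ⟨w', hw', hz'⟩ := hz'
  refine ⟨_, fun j => Submodule.sum_mem _ fun p hp => ?_, hz.mul hz'⟩
  rw [← Finset.HasAntidiagonal.mem_antidiagonal.1 hp]
  exact h _ _ (Submodule.mul_mem_mul (hw _) (hw' _))

/-- Series `∑ₖ π ^ k z_{K + k}` of elements of `seriesSubmodule π F`. -/
theorem exists_sum_mem_seriesSubmodule {F : ℕ → Submodule V R} (hF : Monotone F)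
    {z : ℕ → PiAdic π R} (hz : ∀ k, z k ∈ seriesSubmodule π F) :
    ∃ Z : ℕ → PiAdic π R, ∀ k, Z k ∈ seriesSubmodule π F ∧ Z k = z k + π • Z (k + 1) := by
  choose w hw hz using hz
  -- Diagonal resummation: the `π ^ n` coefficient of `∑ᵢ π ^ i z_{k + i}` takes the `j`-th
  -- coefficient of `z_{k + n - j}` for each `j ≤ n`. All of these lie in `F n` because `F` is
  -- monotone.
  choose Z hZ using fun k => exists_isPiSum π fun n =>
    ∑ j ∈ Finset.range (n + 1), w (k + n - j) j
  refine ⟨Z, fun k => ⟨⟨_, fun n => Submodule.sum_mem _ fun j hj => ?_, hZ k⟩, ?_⟩⟩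
  · exact hF (by rw [Finset.mem_range] at hj; omega) (hw _ j)
  · refine (hZ k).unique ?_
    have h1 : IsPiSum π (π ^ 1 • Z (k + 1)) (fun n => ∑ j ∈ Finset.range n, w (k + n - j) j) := by
      refine (hZ (k + 1)).pow_smul 1 (fun j hj => ?_) (fun j => ?_)
      · rw [Nat.lt_one_iff.1 hj, Finset.sum_range_zero]
      · simp only [add_comm 1 j, add_assoc]
    rw [pow_one] at h1
    convert (hz k).add h1 using 1
    funext n
    rw [Finset.sum_range_succ, Pi.add_apply, add_comm, Nat.add_sub_cancel]

/-- The filtration `M ^ ⌊c (j + 1)⌋` of linear growth. -/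
noncomputable def linFiltration (M : Submodule V R) (c : ℝ) (j : ℕ) : Submodule V R :=
  M ^ ⌊c * (j + 1)⌋₊

theorem pow_le_linFiltration {M : Submodule V R} (h1 : (1 : R) ∈ M) {c : ℝ} {j n : ℕ}
    (h : (n : ℝ) ≤ c * (j + 1)) : M ^ n ≤ linFiltration M c j :=
  pow_le_pow_of_one_mem h1 (Nat.le_floor h)

theorem linFiltration_le {M M' : Submodule V R} (h1 : (1 : R) ∈ M') (hM : M ≤ M') {c c' : ℝ}
    {i j : ℕ} (h : c * (i + 1) ≤ c' * (j + 1)) : linFiltration M c i ≤ linFiltration M' c' j :=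
  (pow_le_pow_left' hM _).trans (pow_le_pow_of_one_mem h1 (Nat.floor_mono h))

theorem linFiltration_mono {M : Submodule V R} (h1 : (1 : R) ∈ M) {c : ℝ} (hc : 0 ≤ c) :
    Monotone (linFiltration M c) := fun i j h => linFiltration_le h1 le_rfl (by gcongr)

/-- The powers of `M` increase because `1 ∈ M`, so every `κⱼ` may be raised to the largest exponent
allowed. The variable exponents thus become a fixed filtration. -/
theorem daggerSet_eq {M : Submodule V R} (h1 : (1 : R) ∈ M) {c : ℝ} (hc : 0 ≤ c) :
    daggerSet π M c = seriesSubmodule π (linFiltration M c) := by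
  ext z
  constructor
  · rintro ⟨w, κ, hw, hκ, hz⟩
    exact ⟨w, fun j => pow_le_linFiltration h1 (hκ j) (hw j), hz⟩
  · rintro ⟨w, hw, hz⟩
    exact ⟨w, fun j => ⌊c * (j + 1)⌋₊, hw, fun j => Nat.floor_le (by positivity), hz⟩

end Series

/-! ### Generalities on convex bornologies -/

section Bornology

variable {V : Type*} [CommRing V] {M : Type*} [AddCommGroup M] [Module V M]
  {N : Type*} [AddCommGroup N] [Module V N]

theorem ConvexBornology.Bdd.of_finite {B : ConvexBornology V M} {S : Set M} (hS : S.Finite) :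
    B.Bdd S := by
  induction S, hS using Set.Finite.induction_on with
  | empty => exact B.bdd_empty
  | insert _ _ h => exact (B.bdd_singleton _).union h

theorem ConvexBornology.bdd_of_fg {B : ConvexBornology V M} {F : Submodule V M} (hF : F.FG) :
    B.Bdd (F : Set M) := by
  obtain ⟨t, rfl⟩ := hF
  exact (Bdd.of_finite t.finite_toSet).span

theorem bdd_of_bdd_fineBornology {B : ConvexBornology V M} {S : Set M}
    (hS : (fineBornology V M).Bdd S) : B.Bdd S := by
  obtain ⟨F, hF, h⟩ := (ConvexBornology.bdd_ofBdd S).1 hS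
  exact (ConvexBornology.bdd_of_fg hF).subset h

/-- The preimage of a bornology under a linear map. -/
def ConvexBornology.comap (B : ConvexBornology V N) (f : M →ₗ[V] N) : ConvexBornology V M :=
  ConvexBornology.ofBdd {S | B.Bdd (f '' S)} (by simpa using B.bdd_empty)
    (fun _ hs _ ht => hs.subset (Set.image_mono ht))
    (fun _ hs _ ht => by
      rw [Set.mem_ofPred_eq, Set.image_union]
      exact hs.union ht)
    (fun x => by simpa using B.bdd_singleton (f x))
    (fun S hs => by
      have := hs.span
      rwa [← Submodule.map_span] at this)

theorem ConvexBornology.bdd_comap {B : ConvexBornology V N} {f : M →ₗ[V] N} {S : Set M} :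
    (B.comap f).Bdd S ↔ B.Bdd (f '' S) :=
  ConvexBornology.bdd_ofBdd S

end Bornology

/-! ### `R†` is a complete bornological algebra and receives a bounded map from `R` -/

section DaggerBornology

variable {V : Type*} [CommRing V] {π : V} {R : Type*} [CommRing R] [Algebra V R]

theorem bdd_daggerBornology {S : Set (dagger π R)} : (daggerBornology π R).Bdd S ↔
    ∃ (M : Submodule V R) (c : ℝ), M.FG ∧ (1 : R) ∈ M ∧ 0 < c ∧
      ∀ z ∈ S, (z : PiAdic π R) ∈ seriesSubmodule π (linFiltration M c) := by
  refine (ConvexBornology.bdd_ofBdd S).trans (exists_congr fun M => exists_congr fun c => ?_)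
  refine and_congr_right fun hM => and_congr_right fun h1 => and_congr_right fun hc => ?_
  rw [daggerSet_eq h1 hc.le]
  rfl

theorem mem_dagger {z : PiAdic π R} : z ∈ dagger π R ↔
    ∃ (M : Submodule V R) (c : ℝ), M.FG ∧ (1 : R) ∈ M ∧ 0 < c ∧
      z ∈ seriesSubmodule π (linFiltration M c) := by
  change (∃ (M : Submodule V R) (c : ℝ), _) ↔ _
  refine exists_congr fun M => exists_congr fun c => ?_
  refine and_congr_right fun hM => and_congr_right fun h1 => and_congr_right fun hc => ?_
  rw [daggerSet_eq h1 hc.le]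
  rfl

theorem isAlgebraBornology_dagger : IsAlgebraBornology (daggerBornology π R) := by
  rintro S T hS hT
  obtain ⟨M, c, hM, h1, hc, h⟩ := (ConvexBornology.bdd_ofBdd S).1 hS
  obtain ⟨M', c', hM', h1', hc', h'⟩ := (ConvexBornology.bdd_ofBdd T).1 hT
  refine (ConvexBornology.bdd_ofBdd _).2 ⟨M ⊔ M', c + c', hM.sup hM', le_sup_left (a := M) h1,
    by positivity, ?_⟩
  rintro _ ⟨x, hx, y, hy, rfl⟩
  exact mul_mem_daggerSet h1 h1' hc hc' (h x hx) (h' y hy)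

theorem toDagger_coe (r : R) : (toDagger π R r : PiAdic π R) = algebraMap R (PiAdic π R) r := rfl

theorem eq_of_forall_sub_eq_pow_smul {x y : PiAdic π R} (h : ∀ n : ℕ, ∃ z, x - y = π ^ n • z) :
    x = y := by
  refine AdicCompletion.ext_evalₐ fun n => ?_
  obtain ⟨z, hz⟩ := h n
  rw [← sub_eq_zero, ← map_sub, hz, evalₐ_smul]
  obtain ⟨r, hr⟩ := Ideal.Quotient.mk_surjective (AdicCompletion.evalₐ _ n z)
  rw [← hr, ← mk_smul', mk_pow_smul le_rfl]

theorem isSeparated_dagger : IsSeparated π (daggerBornology π R) := by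
  rintro S T x a b - - ⟨δ, hδ, hx⟩ ⟨δ', hδ', hx'⟩
  refine Subtype.ext (eq_of_forall_sub_eq_pow_smul fun k => ?_)
  obtain ⟨n, hn⟩ := hδ k
  obtain ⟨n', hn'⟩ := hδ' k
  obtain ⟨v, hv⟩ := hn _ (le_max_left n n')
  obtain ⟨v', hv'⟩ := hn' _ (le_max_right n n')
  obtain ⟨s, -, hs⟩ := hx (max n n')
  obtain ⟨s', -, hs'⟩ := hx' (max n n')
  refine ⟨((v' • s' - v • s : dagger π R) : PiAdic π R), ?_⟩
  have : a - b = π ^ k • (v' • s' - v • s) := by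
    rw [smul_sub, smul_smul, smul_smul, ← hv, ← hv']
    dsimp only at hs hs'
    rw [hs, hs']
    abel
  rw [← Subalgebra.coe_sub, this, Subalgebra.coe_smul]

/-- Along a subsequence the successive differences are `π ^ k z k` with `z k ∈ S`. The tails `Z k =
∑ⱼ π ^ j z (k + j)` again lie in `S`, so the telescoping series converges with respect to the same
set. -/
theorem exists_sConverges_dagger {M : Submodule V R} {c : ℝ} (hM : M.FG) (h1 : (1 : R) ∈ M)
    (hc : 0 < c) {x : ℕ → dagger π R} {S : Set (dagger π R)}
    (hS : ∀ z, z ∈ S ↔ (z : PiAdic π R) ∈ seriesSubmodule π (linFiltration M c))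
    (hx : SCauchy π S x) : ∃ a, SConverges π S x a := by
  obtain ⟨δ, hδ, hx⟩ := hx
  choose n₀ hn₀ using hδ
  -- The summand `1` makes `l` strictly increasing, and `l k ≥ n₀ k` for `k > 0`. Divisibility by `π
  -- ^ 0` is free, so `l 0 = 0` is allowed and the limit is `x 0 + Z 0`.
  let l : ℕ → ℕ := fun k => ∑ i ∈ Finset.range k, (n₀ (i + 1) + 1)
  have hlmono : StrictMono l := strictMono_nat_of_lt_succ fun k => by
    simp only [l, Finset.sum_range_succ]; omega
  have hl : ∀ k n m, l k ≤ n → l k ≤ m → ∃ s ∈ S, x n - x m = π ^ k • s := by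
    intro k n m hn hm
    obtain ⟨s, hs, hs'⟩ := hx n m (l k) hn hm
    have hdvd : π ^ k ∣ δ (l k) := by
      cases k with
      | zero => simp
      | succ k => exact hn₀ _ _ (by simp only [l, Finset.sum_range_succ]; omega)
    obtain ⟨v, hv⟩ := hdvd
    refine ⟨v • s, (hS _).2 ?_, ?_⟩
    · rw [Subalgebra.coe_smul]
      exact Submodule.smul_mem _ _ ((hS s).1 hs)
    · rw [← hs', smul_smul, ← hv]
  choose z hzS hz using fun k =>
    hl k (l (k + 1)) (l k) (hlmono.monotone (Nat.le_succ k)) le_rfl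
  obtain ⟨Z, hZ⟩ := exists_sum_mem_seriesSubmodule (linFiltration_mono h1 hc.le)
    fun k => (hS _).1 (hzS k)
  lift Z to ℕ → dagger π R using fun k => mem_dagger.2 ⟨M, c, hM, h1, hc, (hZ k).1⟩
  have hZ' : ∀ k, Z k = z k + π • Z (k + 1) := fun k => Subtype.ext (hZ k).2
  have ha : ∀ k, x 0 + Z 0 = x (l k) + π ^ k • Z k := by
    intro k
    induction k with
    | zero => simp [l]
    | succ k ih =>
      rw [ih, hZ' k, smul_add, ← hz, smul_smul, ← pow_succ]
      abel
  -- For the full sequence, index `n` is compared with the last term `l k ≤ n` of the subsequence.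
  -- The search bound `n` loses nothing since `k ≤ l k`.
  refine ⟨x 0 + Z 0, fun n => π ^ Nat.findGreatest (fun k => l k ≤ n) n, fun k => ⟨l k, ?_⟩, ?_⟩
  · intro n hn
    exact pow_dvd_pow _ (Nat.le_findGreatest ((hlmono.id_le k).trans hn) hn)
  · intro n
    dsimp only
    set k := Nat.findGreatest (fun k => l k ≤ n) n
    have hk : l k ≤ n := Nat.findGreatest_spec (P := fun k => l k ≤ n) (Nat.zero_le n) (by simp [l])
    obtain ⟨s, hs, hs'⟩ := hl k n (l k) hk le_rfl
    refine ⟨s - Z k, (hS _).2 (sub_mem ((hS _).1 hs) (hZ k).1), ?_⟩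
    dsimp only
    rw [ha k, smul_sub, ← hs']
    abel

theorem isComplete_dagger : IsComplete π (daggerBornology π R) := by
  refine ⟨isSeparated_dagger, fun S hS => ?_⟩
  obtain ⟨M, c, hM, h1, hc, h⟩ := bdd_daggerBornology.1 hS
  refine ⟨{z | (z : PiAdic π R) ∈ seriesSubmodule π (linFiltration M c)},
    bdd_daggerBornology.2 ⟨M, c, hM, h1, hc, fun z hz => hz⟩, fun x hx => ?_⟩
  refine exists_sConverges_dagger hM h1 hc (fun z => Iff.rfl) ?_
  obtain ⟨δ, hδ, hx⟩ := hx
  exact ⟨δ, hδ, fun n m l hn hm => Set.smul_set_mono h (hx n m l hn hm)⟩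

/-- The pull-back of `seriesSubmodule π F` to `R`. -/
noncomputable def seriesComap (π : V) (F : ℕ → Submodule V R) : Submodule V R :=
  (seriesSubmodule π F).comap (IsScalarTower.toAlgHom V R (PiAdic π R)).toLinearMap

theorem mem_seriesComap {F : ℕ → Submodule V R} {r : R} :
    r ∈ seriesComap π F ↔ algebraMap R (PiAdic π R) r ∈ seriesSubmodule π F := Iff.rfl

theorem mem_seriesComap_of_mem {F : ℕ → Submodule V R} {r : R} (hr : r ∈ F 0) :
    r ∈ seriesComap π F := by
  refine mem_seriesComap.2 ⟨_, fun j => ?_, isPiSum_algebraMap r⟩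
  split_ifs with h
  · exact h ▸ hr
  · exact zero_mem _

theorem seriesComap_mul_le {F F' F'' : ℕ → Submodule V R} (h : ∀ i j, F i * F' j ≤ F'' (i + j)) :
    seriesComap π F * seriesComap π F' ≤ seriesComap π F'' := by
  refine Submodule.mul_le.2 fun m hm n hn => ?_
  rw [mem_seriesComap, map_mul]
  exact mul_mem_seriesSubmodule h hm hn

/-- Under multiplication of series both the indices and the offsets `1` in `c (j + 1)` add up. So a
product of `n` factors has degree at most `c (j + n)`: the slope in `j` does not grow with `n`. -/
theorem pow_le_seriesComap {M : Submodule V R} (h1 : (1 : R) ∈ M) {c : ℝ} (hc : 0 ≤ c)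
    {N : Submodule V R} (hN : N ≤ seriesComap π (linFiltration M c)) (n : ℕ) :
    N ^ n ≤ seriesComap π (fun j => M ^ ⌊c * (j + n)⌋₊) := by
  induction n with
  | zero =>
    rw [pow_zero]
    refine fun r hr => mem_seriesComap_of_mem ?_
    simpa using hr
  | succ n ih =>
    rw [pow_succ]
    refine (mul_le_mul' ih hN).trans (seriesComap_mul_le fun i j => ?_)
    rw [linFiltration, ← pow_add]
    refine pow_le_pow_of_one_mem h1 (Nat.le_floor ?_)
    have e1 : (⌊c * (i + n)⌋₊ : ℝ) ≤ c * (i + n) := Nat.floor_le (by positivity)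
    have e2 : (⌊c * (j + 1)⌋₊ : ℝ) ≤ c * (j + 1) := Nat.floor_le (by positivity)
    push_cast
    linarith

/-- With `ρ = -log_ε r > 0`, the `n`-th summand carries the factor `π ^ m`, `m = ⌈n ρ⌉`, which
shifts series by `m`. As `n ≤ m / ρ`, the offset `c n` is absorbed by a larger slope that is
independent of `n`. -/
theorem powerSum_le_seriesComap {M : Submodule V R} (h1 : (1 : R) ∈ M) {c : ℝ} (hc : 0 ≤ c)
    {ε r : ℝ} (hε0 : 0 < ε) (hε1 : ε < 1) (hr : 1 < r) {N : Submodule V R}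
    (hN : N ≤ seriesComap π (linFiltration M c)) :
    powerSum π ε r N ≤ seriesComap π (linFiltration M (c * (1 + (-Real.logb ε r)⁻¹))) := by
  refine iSup_le fun n => ?_
  rintro _ ⟨s, hs, rfl⟩
  have hρ : 0 < -Real.logb ε r :=
    neg_pos.2 (Real.logb_neg_of_base_lt_one hε0 hε1 hr)
  set ρ := -Real.logb ε r with hρdef
  have hlog : Real.logb ε ((r ^ n)⁻¹) = n * ρ := by
    rw [Real.logb_inv, Real.logb_pow, hρdef, mul_neg]
  rw [hlog]
  have hn : (n : ℝ) * ρ ≤ ⌈(n : ℝ) * ρ⌉₊ := Nat.le_ceil _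
  set m := ⌈(n : ℝ) * ρ⌉₊
  have hn' : (n : ℝ) ≤ m * ρ⁻¹ := by
    rwa [← div_eq_mul_inv, le_div_iff₀ hρ]
  have hρ' : 0 < ρ⁻¹ := inv_pos.2 hρ
  rw [mem_seriesComap]
  have h2 : algebraMap R (PiAdic π R) (DistribSMul.toLinearMap V R (π ^ m) s) =
      π ^ m • algebraMap R (PiAdic π R) s :=
    (IsScalarTower.toAlgHom V R (PiAdic π R)).toLinearMap.map_smul _ _
  rw [h2]
  refine pow_smul_mem_seriesSubmodule m (fun j => ?_) (pow_le_seriesComap h1 hc hN n hs)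
  refine pow_le_pow_of_one_mem h1 (Nat.floor_mono ?_)
  rw [mul_assoc]
  refine mul_le_mul_of_nonneg_left ?_ hc
  push_cast
  have : 0 ≤ (j : ℝ) * ρ⁻¹ := by positivity
  nlinarith

theorem bdd_image_toDagger {N : Submodule V R} :
    (daggerBornology π R).Bdd ((toDagger π R).toLinearMap '' N) ↔
      ∃ (M : Submodule V R) (c : ℝ), M.FG ∧ (1 : R) ∈ M ∧ 0 < c ∧
        N ≤ seriesComap π (linFiltration M c) := by
  rw [bdd_daggerBornology]
  simp only [Set.forall_mem_image]
  rfl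

theorem isGrowthBornology_comap_toDagger {ε : ℝ} (hε0 : 0 < ε) (hε1 : ε < 1) :
    IsGrowthBornology π ε (fineBornology V R)
      ((daggerBornology π R).comap (toDagger π R).toLinearMap) := by
  refine ⟨fun S T hS hT => ?_, fun S hS => bdd_of_bdd_fineBornology hS, fun N hN => ?_⟩
  · rw [ConvexBornology.bdd_comap] at *
    have := isAlgebraBornology_dagger _ _ hS hT
    simpa only [AlgHom.toLinearMap_apply, AlgHom.coe_toLinearMap, Set.image_mul] using this
  · refine (specRadius_le_one_iff hε0 hε1).2 fun r hr => ?_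
    rw [ConvexBornology.bdd_comap] at *
    obtain ⟨M, c, hM, h1, hc, h⟩ := bdd_image_toDagger.1 hN
    refine bdd_image_toDagger.2 ⟨M, _, hM, h1, ?_, powerSum_le_seriesComap h1 hc.le hε0 hε1 hr h⟩
    have := neg_pos.2 (Real.logb_neg_of_base_lt_one hε0 hε1 hr)
    positivity

theorem isBoundedMap_toDagger {ε : ℝ} (hε0 : 0 < ε) (hε1 : ε < 1) :
    IsBoundedMap (linearGrowth π ε (fineBornology V R)) (daggerBornology π R)
      (toDagger π R).toLinearMap := fun _ hS =>
  ConvexBornology.bdd_comap.1 (linearGrowth_le (isGrowthBornology_comap_toDagger hε0 hε1) hS)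

end DaggerBornology

/-! ### Bornological convergence with rates given by powers of `π` -/

section Convergence

open Filter

variable {V : Type*} [CommRing V] {π : V} {M : Type*} [AddCommGroup M] [Module V M]
  {N : Type*} [AddCommGroup N] [Module V N]

/-- Bornological convergence, with explicit rates `π ^ κ n`. -/
def BornConverges (π : V) (B : ConvexBornology V M) (x : ℕ → M) (a : M) : Prop :=
  ∃ (S : Submodule V M) (κ : ℕ → ℕ), B.Bdd (S : Set M) ∧ Tendsto κ atTop atTop ∧
    ∀ n, ∃ s ∈ S, x n - a = π ^ κ n • s

theorem tendsToZero_pow {κ : ℕ → ℕ} (hκ : Tendsto κ atTop atTop) :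
    TendsToZero π fun n => π ^ κ n := fun k => by
  obtain ⟨n₀, h⟩ := eventually_atTop.1 (tendsto_atTop.1 hκ k)
  exact ⟨n₀, fun n hn => pow_dvd_pow _ (h n hn)⟩

theorem TendsToZero.exists_pow_dvd {δ : ℕ → V} (hδ : TendsToZero π δ) :
    ∃ κ : ℕ → ℕ, Tendsto κ atTop atTop ∧ ∀ n, π ^ κ n ∣ δ n := by
  classical
  -- The exponent is capped at `n` because `δ n` may be divisible by all powers of `π`, for instance
  -- when it is `0`.
  refine ⟨fun n => Nat.findGreatest (fun k => π ^ k ∣ δ n) n, tendsto_atTop.2 fun k => ?_,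
    fun n => Nat.findGreatest_spec (P := fun k => π ^ k ∣ δ n) (Nat.zero_le n) (by simp)⟩
  obtain ⟨n₀, h⟩ := hδ k
  refine eventually_atTop.2 ⟨max n₀ k, fun n hn => ?_⟩
  exact Nat.le_findGreatest ((le_max_right _ _).trans hn) (h n ((le_max_left _ _).trans hn))

theorem SConverges.bornConverges {B : ConvexBornology V M} {S : Set M} {x : ℕ → M} {a : M}
    (h : SConverges π S x a) (hS : B.Bdd S) : BornConverges π B x a := by
  obtain ⟨δ, hδ, hx⟩ := h
  obtain ⟨κ, hκ, hdvd⟩ := hδ.exists_pow_dvd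
  refine ⟨Submodule.span V S, κ, hS.span, hκ, fun n => ?_⟩
  obtain ⟨s, hs, hs'⟩ := hx n
  obtain ⟨v, hv⟩ := hdvd n
  exact ⟨v • s, Submodule.smul_mem _ _ (Submodule.subset_span hs), by rw [← hs', smul_smul, ← hv]⟩

theorem BornConverges.exists_sConverges {B : ConvexBornology V M} {x : ℕ → M} {a : M}
    (h : BornConverges π B x a) : ∃ S, B.Bdd S ∧ SConverges π S x a := by
  obtain ⟨S, κ, hS, hκ, hx⟩ := h
  refine ⟨S, hS, _, tendsToZero_pow hκ, fun n => ?_⟩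
  obtain ⟨s, hs, hs'⟩ := hx n
  exact ⟨s, hs, hs'.symm⟩

theorem BornConverges.unique {B : ConvexBornology V M} (hB : IsSeparated π B) {x : ℕ → M}
    {a b : M} (ha : BornConverges π B x a) (hb : BornConverges π B x b) : a = b := by
  obtain ⟨S, hS, ha⟩ := ha.exists_sConverges
  obtain ⟨T, hT, hb⟩ := hb.exists_sConverges
  exact hB S T x a b hS hT ha hb

theorem ConvexBornology.Bdd.sup {B : ConvexBornology V M} {S T : Submodule V M}
    (hS : B.Bdd (S : Set M)) (hT : B.Bdd (T : Set M)) : B.Bdd (S ⊔ T : Submodule V M) := by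
  have := (hS.union hT).span
  rwa [Submodule.span_union, Submodule.span_eq, Submodule.span_eq] at this

theorem BornConverges.add {B : ConvexBornology V M} {x y : ℕ → M} {a b : M}
    (hx : BornConverges π B x a) (hy : BornConverges π B y b) :
    BornConverges π B (fun n => x n + y n) (a + b) := by
  obtain ⟨S, κ, hS, hκ, hx⟩ := hx
  obtain ⟨T, μ, hT, hμ, hy⟩ := hy
  refine ⟨S ⊔ T, fun n => min (κ n) (μ n), hS.sup hT, tendsto_atTop.2 fun k => ?_, fun n => ?_⟩
  · filter_upwards [tendsto_atTop.1 hκ k, tendsto_atTop.1 hμ k] with n h1 h2 using le_min h1 h2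
  · obtain ⟨s, hs, hs'⟩ := hx n
    obtain ⟨t, ht, ht'⟩ := hy n
    refine ⟨π ^ (κ n - min (κ n) (μ n)) • s + π ^ (μ n - min (κ n) (μ n)) • t,
      add_mem (Submodule.smul_mem _ _ (Submodule.mem_sup_left hs))
        (Submodule.smul_mem _ _ (Submodule.mem_sup_right ht)), ?_⟩
    rw [smul_add, smul_smul, smul_smul, ← pow_add, ← pow_add,
      Nat.add_sub_cancel' (min_le_left _ _), Nat.add_sub_cancel' (min_le_right _ _), ← hs', ← ht']
    exact add_sub_add_comm _ _ _ _

theorem BornConverges.smul {B : ConvexBornology V M} {x : ℕ → M} {a : M} (v : V)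
    (hx : BornConverges π B x a) : BornConverges π B (fun n => v • x n) (v • a) := by
  obtain ⟨S, κ, hS, hκ, hx⟩ := hx
  refine ⟨S, κ, hS, hκ, fun n => ?_⟩
  obtain ⟨s, hs, hs'⟩ := hx n
  exact ⟨v • s, S.smul_mem _ hs, by rw [← smul_sub, hs', smul_comm]⟩

theorem BornConverges.map {B : ConvexBornology V M} {B' : ConvexBornology V N} {x : ℕ → M} {a : M}
    {f : M →ₗ[V] N} (hf : IsBoundedMap B B' f) (hx : BornConverges π B x a) :
    BornConverges π B' (fun n => f (x n)) (f a) := by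
  obtain ⟨S, κ, hS, hκ, hx⟩ := hx
  refine ⟨S.map f, κ, hf _ hS, hκ, fun n => ?_⟩
  obtain ⟨s, hs, hs'⟩ := hx n
  exact ⟨f s, ⟨s, hs, rfl⟩, by rw [← map_sub, hs', map_smul]⟩

theorem SCauchy.map {S : Set M} {x : ℕ → M} (f : M →ₗ[V] N) (hx : SCauchy π S x) :
    SCauchy π (f '' S) (fun n => f (x n)) := by
  obtain ⟨δ, hδ, hx⟩ := hx
  refine ⟨δ, hδ, fun n m l hn hm => ?_⟩
  obtain ⟨s, hs, hs'⟩ := hx n m l hn hm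
  refine ⟨f s, ⟨s, hs, rfl⟩, ?_⟩
  dsimp only at hs' ⊢
  rw [← map_sub, ← hs', map_smul]

end Convergence

/-! ### Series of linear growth in `R` and in `R†` -/

section LinearGrowth

variable {V : Type*} [CommRing V] {π : V} {R : Type*} [CommRing R] [Algebra V R]

/-- The submodule `∑ⱼ π ^ j M ^ ⌊c (j + 1)⌋`. -/
noncomputable def linSum (π : V) (M : Submodule V R) (c : ℝ) : Submodule V R :=
  ⨆ j : ℕ, π ^ j • linFiltration M c j

theorem pow_smul_mem_linSum {M : Submodule V R} {c : ℝ} {j : ℕ} {r : R}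
    (hr : r ∈ linFiltration M c j) : π ^ j • r ∈ linSum π M c :=
  (le_iSup (fun j : ℕ => π ^ j • linFiltration M c j) j) ⟨r, hr, rfl⟩

theorem bdd_linSum {ε : ℝ} (hε0 : 0 < ε) (hε1 : ε < 1) {M : Submodule V R} (hM : M.FG) {c : ℝ}
    (hc : 0 < c) : (linearGrowth π ε (fineBornology V R)).Bdd (linSum π M c : Set R) := by
  refine bdd_linearGrowth.2 fun B' hB' => ?_
  -- For this radius `M ^ N` is multiplied by `π ^ ⌈N / (2 c)⌉`. With `N = ⌊c (j + 1)⌋` the quotient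
  -- is at most `(j + 1) / 2`, hence at most `j` once `j ≥ 1`. The remaining term `j = 0` is the
  -- finitely generated module `M ^ ⌊c⌋`, which is added separately.
  have hr : 1 < ε ^ (-(2 * c)⁻¹) :=
    Real.one_lt_rpow_of_pos_of_lt_one_of_neg hε0 hε1 (neg_neg_of_pos (by positivity))
  have h1 := (specRadius_le_one_iff hε0 hε1).1
    (hB'.2.2 M (ConvexBornology.bdd_of_fg hM)) _ hr
  refine (ConvexBornology.Bdd.sup (ConvexBornology.bdd_of_fg (hM.pow ⌊c⌋₊)) h1).subset
    (SetLike.coe_subset_coe.2 (iSup_le fun j => ?_))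
  rcases Nat.eq_zero_or_pos j with rfl | hj
  · refine le_trans ?_ le_sup_left
    rintro _ ⟨s, hs, rfl⟩
    simpa [linFiltration] using hs
  · refine le_trans ?_ (le_trans (le_iSup _ ⌊c * (j + 1)⌋₊) le_sup_right)
    rintro _ ⟨s, hs, rfl⟩
    have hlog : Real.logb ε (((ε ^ (-(2 * c)⁻¹)) ^ ⌊c * ((j : ℝ) + 1)⌋₊)⁻¹) =
        ⌊c * ((j : ℝ) + 1)⌋₊ * (2 * c)⁻¹ := by
      rw [Real.logb_inv, Real.logb_pow, Real.logb_rpow hε0 hε1.ne]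
      ring
    have hle : ⌈Real.logb ε (((ε ^ (-(2 * c)⁻¹)) ^ ⌊c * ((j : ℝ) + 1)⌋₊)⁻¹)⌉₊ ≤ j := by
      rw [hlog]
      refine Nat.ceil_le.2 ?_
      have e1 : (⌊c * ((j : ℝ) + 1)⌋₊ : ℝ) ≤ c * (j + 1) := Nat.floor_le (by positivity)
      have e2 : (1 : ℝ) ≤ j := by exact_mod_cast hj
      rw [← div_eq_mul_inv, div_le_iff₀ (by positivity)]
      nlinarith
    obtain ⟨k, hk⟩ := Nat.exists_eq_add_of_le hle
    refine ⟨π ^ k • s, Submodule.smul_mem _ _ hs, ?_⟩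
    change π ^ _ • π ^ k • s = π ^ j • s
    rw [smul_smul, ← pow_add, ← hk]

/-- A tail starting at `m` can give away `π ^ (m / 2)` as a convergence rate: the exponents left are
at least half the original ones, so doubling `c` compensates. -/
theorem linFiltration_add_le {M : Submodule V R} (h1 : (1 : R) ∈ M) {c : ℝ} (hc : 0 < c)
    (m j : ℕ) : linFiltration M c (m + j) ≤ linFiltration M (2 * c) (m - m / 2 + j) := by
  refine linFiltration_le h1 le_rfl ?_
  have h : ((m + j + 1 : ℕ) : ℝ) ≤ ((2 * (m - m / 2 + j + 1) : ℕ) : ℝ) := by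
    exact_mod_cast (by omega)
  have := mul_le_mul_of_nonneg_left h hc.le
  push_cast at this ⊢
  linarith

theorem pow_smul_partialSum_mem {M : Submodule V R} (h1 : (1 : R) ∈ M) {c : ℝ} (hc : 0 < c)
    {w : ℕ → R} (hw : ∀ j, w j ∈ linFiltration M c j) (m n : ℕ) :
    π ^ (m - m / 2) • partialSum π (fun j => w (m + j)) n ∈ linSum π M (2 * c) := by
  rw [partialSum, Finset.smul_sum]
  refine Submodule.sum_mem _ fun j _ => ?_
  rw [smul_smul, ← pow_add]
  exact pow_smul_mem_linSum (linFiltration_add_le h1 hc m j (hw _))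

theorem tendsto_half : Filter.Tendsto (fun n : ℕ => n / 2) Filter.atTop Filter.atTop :=
  Filter.tendsto_atTop.2 fun k => Filter.eventually_atTop.2 ⟨2 * k, fun n hn => by omega⟩

theorem pow_eq_pow_half_mul (π : V) (n : ℕ) : π ^ n = π ^ (n / 2) * π ^ (n - n / 2) := by
  rw [← pow_add]
  congr 1
  omega

theorem sCauchy_partialSum {M : Submodule V R} (h1 : (1 : R) ∈ M) {c : ℝ} (hc : 0 < c)
    {w : ℕ → R} (hw : ∀ j, w j ∈ linFiltration M c j) :
    SCauchy π (linSum π M (2 * c) : Set R) (partialSum π w) := by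
  refine ⟨_, tendsToZero_pow tendsto_half, fun n m l hn hm => ?_⟩
  obtain ⟨n, rfl⟩ := Nat.exists_eq_add_of_le hn
  obtain ⟨m, rfl⟩ := Nat.exists_eq_add_of_le hm
  refine ⟨_, sub_mem (pow_smul_partialSum_mem h1 hc hw l n) (pow_smul_partialSum_mem h1 hc hw l m),
    ?_⟩
  dsimp only
  rw [partialSum_add_index, partialSum_add_index, smul_sub, smul_smul, smul_smul,
    ← pow_eq_pow_half_mul]
  abel

theorem exists_fg_generating (V R : Type*) [CommRing V] [CommRing R] [Algebra V R]
    [Algebra.FiniteType V R] : ∃ M : Submodule V R, M.FG ∧ (1 : R) ∈ M ∧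
      ∀ r : R, ∃ m : ℕ, r ∈ M ^ m := by
  obtain ⟨t, ht⟩ := Algebra.FiniteType.out (R := V) (A := R)
  have h1 : (1 : R) ∈ Submodule.span V (insert 1 (t : Set R)) :=
    Submodule.subset_span (Set.mem_insert _ _)
  refine ⟨Submodule.span V (insert 1 (t : Set R)), Submodule.fg_span (t.finite_toSet.insert 1), h1,
    fun r => ?_⟩
  have hr : r ∈ Algebra.adjoin V (t : Set R) := ht ▸ Algebra.mem_top
  induction hr using Algebra.adjoin_induction with
  | mem x hx =>
    exact ⟨1, by rw [pow_one]; exact Submodule.subset_span (Set.mem_insert_of_mem _ hx)⟩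
  | algebraMap v => exact ⟨0, by rw [pow_zero]; exact Submodule.algebraMap_mem v⟩
  | add x y _ _ hx hy =>
    obtain ⟨m, hm⟩ := hx
    obtain ⟨n, hn⟩ := hy
    exact ⟨max m n, add_mem (pow_le_pow_of_one_mem h1 (le_max_left _ _) hm)
      (pow_le_pow_of_one_mem h1 (le_max_right _ _) hn)⟩
  | mul x y _ _ hx hy =>
    obtain ⟨m, hm⟩ := hx
    obtain ⟨n, hn⟩ := hy
    exact ⟨m + n, by rw [pow_add]; exact Submodule.mul_mem_mul hm hn⟩

/-- If a series of linear growth sums to `0` in the `π`-adic completion, then its partial sums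
converge to `0` in the linear growth bornology. -/
theorem bornConverges_partialSum_zero [IsNoetherianRing V] [Algebra.FiniteType V R] {ε : ℝ}
    (hε0 : 0 < ε) (hε1 : ε < 1) {M : Submodule V R} (hM : M.FG) (h1 : (1 : R) ∈ M) {c : ℝ}
    (hc : 0 < c) {w : ℕ → R} (hw : ∀ j, w j ∈ linFiltration M c j) (h0 : IsPiSum π 0 w) :
    BornConverges π (linearGrowth π ε (fineBornology V R)) (partialSum π w) 0 := by
  obtain ⟨M₀, hM₀, -, hgen⟩ := exists_fg_generating V R
  -- The Artin–Rees estimate needs an exhaustive filtration, so `M` is enlarged by a generating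
  -- module `M₀`.
  obtain ⟨k, hk⟩ := exists_forall_mem_pow_smul π (hM.sup hM₀) (le_sup_left (a := M) h1)
    fun r => (hgen r).imp fun m hm => pow_le_pow_left' (le_sup_right : M₀ ≤ M ⊔ M₀) m hm
  set M' := M ⊔ M₀
  have h1' : (1 : R) ∈ M' := le_sup_left (a := M) h1
  refine ⟨linSum π M' (2 * (c + k)), fun n => n / 2,
    bdd_linSum hε0 hε1 (hM.sup hM₀) (by positivity), tendsto_half, fun n => ?_⟩
  have hmem : partialSum π w n ∈ M' ^ ⌊c * ((n : ℝ) + 1)⌋₊ :=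
    Submodule.sum_mem _ fun j hj => Submodule.smul_mem _ _ <|
      linFiltration_le (M := M) h1' le_sup_left (by
        have : (j : ℝ) ≤ n := by exact_mod_cast (Finset.mem_range.1 hj).le
        gcongr) (hw j)
  obtain ⟨r, hr⟩ : ∃ r : R, π ^ n • r = partialSum π w n := by
    refine exists_pow_smul_eq (Ideal.Quotient.eq_zero_iff_mem.1 ?_)
    rw [← isPiSum_iff.1 h0 n, map_zero]
  -- Now `π ^ n` is divided out inside a power of `M'` with exponent `⌊c (n + 1)⌋ + k n`, still
  -- linear in `n`. Half of `π ^ n` serves as the rate, whence the slope `2 (c + k)`.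
  obtain ⟨s, hs, hs'⟩ := hk n _ r (hr ▸ hmem)
  have hs' : π ^ n • s = π ^ n • r := hs'
  refine ⟨π ^ (n - n / 2) • s, pow_smul_mem_linSum (pow_le_linFiltration h1' ?_ hs), ?_⟩
  · have e1 : (⌊c * ((n : ℝ) + 1)⌋₊ : ℝ) ≤ c * (n + 1) := Nat.floor_le (by positivity)
    have e2 : ((n + 1 : ℕ) : ℝ) ≤ ((2 * (n - n / 2 + 1) : ℕ) : ℝ) := by
      exact_mod_cast (by omega)
    push_cast at e2 ⊢
    have e3 : (0 : ℝ) ≤ c + k := by positivity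
    have e4 : (0 : ℝ) ≤ k := by positivity
    nlinarith
  · rw [sub_zero, smul_smul, ← pow_eq_pow_half_mul, hs', hr]

/-- An element `∑ⱼ π ^ j wⱼ` of `R†` is the bornological limit of the partial sums. -/
theorem bornConverges_toDagger_partialSum {M : Submodule V R} (hM : M.FG) (h1 : (1 : R) ∈ M)
    {c : ℝ} (hc : 0 < c) {w : ℕ → R} (hw : ∀ j, w j ∈ linFiltration M c j) {z : dagger π R}
    (hz : IsPiSum π (z : PiAdic π R) w) :
    BornConverges π (daggerBornology π R) (fun n => toDagger π R (partialSum π w n)) z := by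
  refine ⟨(seriesSubmodule π (linFiltration M (2 * c))).comap (dagger π R).val.toLinearMap,
    fun n => n / 2, bdd_daggerBornology.2 ⟨M, 2 * c, hM, h1, by positivity, fun z hz => hz⟩,
    tendsto_half, fun n => ?_⟩
  obtain ⟨z', hz'⟩ := exists_isPiSum π fun j => w (n + j)
  have hmem : π ^ (n - n / 2) • (-z') ∈ seriesSubmodule π (linFiltration M (2 * c)) :=
    pow_smul_mem_seriesSubmodule _ (F := fun j => linFiltration M c (n + j))
      (linFiltration_add_le h1 hc n) (neg_mem ⟨_, fun j => hw _, hz'⟩)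
  refine ⟨⟨_, mem_dagger.2 ⟨M, 2 * c, hM, h1, by positivity, hmem⟩⟩, hmem, Subtype.ext ?_⟩
  rw [Subalgebra.coe_sub, Subalgebra.coe_smul, toDagger_coe, hz.eq_add n hz']
  dsimp only
  rw [smul_smul, ← pow_eq_pow_half_mul, smul_neg]
  abel

end LinearGrowth

/-! ### Extension of bounded maps from `R` to `R†` -/

section Extension

variable {V : Type*} [CommRing V] {π : V} {R : Type*} [CommRing R] [Algebra V R]
  {Y : Type*} [AddCommGroup Y] [Module V Y]

/-- `y` is the limit of the images under `f` of the partial sums of a series for `z`. -/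
def IsSeriesLimit (BY : ConvexBornology V Y) (f : R →ₗ[V] Y) (z : PiAdic π R) (y : Y) : Prop :=
  ∃ (M : Submodule V R) (c : ℝ) (w : ℕ → R), M.FG ∧ (1 : R) ∈ M ∧ 0 < c ∧
    (∀ j, w j ∈ linFiltration M c j) ∧ IsPiSum π z w ∧
    BornConverges π BY (fun n => f (partialSum π w n)) y

theorem IsSeriesLimit.add {BY : ConvexBornology V Y} {f : R →ₗ[V] Y} {z z' : PiAdic π R} {y y' : Y}
    (h : IsSeriesLimit BY f z y) (h' : IsSeriesLimit BY f z' y') :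
    IsSeriesLimit BY f (z + z') (y + y') := by
  obtain ⟨M, c, w, hM, h1, hc, hw, hz, hy⟩ := h
  obtain ⟨M', c', w', hM', -, -, hw', hz', hy'⟩ := h'
  have h1' : (1 : R) ∈ M ⊔ M' := le_sup_left (a := M) h1
  refine ⟨M ⊔ M', max c c', w + w', hM.sup hM', h1', lt_max_of_lt_left hc, fun j => add_mem ?_ ?_,
    hz.add hz', ?_⟩
  · exact linFiltration_le h1' le_sup_left (by gcongr; exact le_max_left _ _) (hw j)
  · exact linFiltration_le h1' le_sup_right (by gcongr; exact le_max_right _ _) (hw' j)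
  · simpa only [partialSum_add, map_add] using hy.add hy'

theorem IsSeriesLimit.smul {BY : ConvexBornology V Y} {f : R →ₗ[V] Y} {z : PiAdic π R} {y : Y}
    (v : V) (h : IsSeriesLimit BY f z y) : IsSeriesLimit BY f (v • z) (v • y) := by
  obtain ⟨M, c, w, hM, h1, hc, hw, hz, hy⟩ := h
  refine ⟨M, c, v • w, hM, h1, hc, fun j => Submodule.smul_mem _ _ (hw j), hz.smul v, ?_⟩
  simpa only [partialSum_smul, map_smul] using hy.smul v

theorem isSeriesLimit_algebraMap (BY : ConvexBornology V Y) (f : R →ₗ[V] Y) (r : R) :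
    IsSeriesLimit BY f (algebraMap R (PiAdic π R) r) (f r) := by
  refine ⟨Submodule.span V {1, r}, 1, _, Submodule.fg_span (Set.toFinite _),
    Submodule.subset_span (by simp), one_pos, fun j => ?_, isPiSum_algebraMap r,
    Submodule.span V {f r}, fun n => n, (BY.bdd_singleton _).span, Filter.tendsto_id,
    fun n => ?_⟩
  · split_ifs with h
    · subst h
      simpa [linFiltration] using Submodule.subset_span (by simp)
    · exact zero_mem _
  -- The empty partial sum has error `-f r`; all later partial sums are exact.
  · rcases n with _ | n
    · refine ⟨-f r, neg_mem (Submodule.subset_span rfl), ?_⟩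
      simp [partialSum]
    · refine ⟨0, zero_mem _, ?_⟩
      simp [partialSum]

/-- The difference of the two series represents `0`, so its partial sums converge to `0` already in
`R`, and `f` preserves this convergence. -/
theorem IsSeriesLimit.unique [IsNoetherianRing V] [Algebra.FiniteType V R] {ε : ℝ}
    (hε0 : 0 < ε) (hε1 : ε < 1) {BY : ConvexBornology V Y} (hBY : IsSeparated π BY)
    {f : R →ₗ[V] Y} (hf : IsBoundedMap (linearGrowth π ε (fineBornology V R)) BY f)
    {z : PiAdic π R} {y y' : Y} (h : IsSeriesLimit BY f z y) (h' : IsSeriesLimit BY f z y') :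
    y = y' := by
  have h0 := h.add (h'.smul (-1))
  rw [neg_one_smul, neg_one_smul, add_neg_cancel] at h0
  obtain ⟨M, c, w, hM, h1, hc, hw, hz, hy⟩ := h0
  have := (bornConverges_partialSum_zero hε0 hε1 hM h1 hc hw hz).map hf
  rw [map_zero] at this
  rw [← sub_eq_zero, sub_eq_add_neg]
  exact hy.unique hBY this

/-- A bounded linear map to a complete module extends to series of linear growth, uniformly. -/
theorem exists_bdd_forall_isSeriesLimit {ε : ℝ} (hε0 : 0 < ε) (hε1 : ε < 1)
    {BY : ConvexBornology V Y} (hBY : IsComplete π BY) {f : R →ₗ[V] Y}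
    (hf : IsBoundedMap (linearGrowth π ε (fineBornology V R)) BY f) {M : Submodule V R}
    (hM : M.FG) (h1 : (1 : R) ∈ M) {c : ℝ} (hc : 0 < c) :
    ∃ S, BY.Bdd S ∧ ∀ z ∈ seriesSubmodule π (linFiltration M c), ∃ y ∈ S,
      IsSeriesLimit BY f z y := by
  obtain ⟨S, hS, h⟩ := hBY.2 _ (hf _ (bdd_linSum hε0 hε1 hM (by positivity : 0 < 2 * c)))
  refine ⟨Submodule.span V S, hS.span, ?_⟩
  rintro z ⟨w, hw, hz⟩
  obtain ⟨y, hy⟩ := h _ ((sCauchy_partialSum h1 hc hw).map f)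
  refine ⟨y, ?_, M, c, w, hM, h1, hc, hw, hz, hy.bornConverges hS⟩
  -- The zeroth partial sum is `0`, so the convergence estimate at index `0` places the limit itself
  -- in the span of `S`, uniformly in `z`.
  obtain ⟨δ, -, hδ⟩ := hy
  obtain ⟨s, hs, hs'⟩ := hδ 0
  have : y = -(δ 0 • s) := by
    simp only [partialSum, Finset.range_zero, Finset.sum_empty, map_zero, zero_sub] at hs'
    rw [hs', neg_neg]
  rw [this]
  exact neg_mem (Submodule.smul_mem _ _ (Submodule.subset_span hs))

/-- The map `g` picks a series limit for each `z`. Uniqueness of these limits gives linearity and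
the values on `R`, and identifies `g z` with the limit found in a fixed bounded set, which gives
boundedness. -/
theorem exists_extension [IsNoetherianRing V] [Algebra.FiniteType V R] {ε : ℝ}
    (hε0 : 0 < ε) (hε1 : ε < 1) {BY : ConvexBornology V Y} (hBY : IsComplete π BY)
    {f : R →ₗ[V] Y} (hf : IsBoundedMap (linearGrowth π ε (fineBornology V R)) BY f) :
    ∃ g : dagger π R →ₗ[V] Y, IsBoundedMap (daggerBornology π R) BY g ∧
      g ∘ₗ (toDagger π R).toLinearMap = f := by
  have hex : ∀ z : dagger π R, ∃ y, IsSeriesLimit BY f (z : PiAdic π R) y := fun z => by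
    obtain ⟨M, c, hM, h1, hc, hz⟩ := mem_dagger.1 z.2
    obtain ⟨S, -, h⟩ := exists_bdd_forall_isSeriesLimit hε0 hε1 hBY hf hM h1 hc
    exact (h z hz).imp fun y hy => hy.2
  choose g hg using hex
  have huniq : ∀ {z : dagger π R} {y : Y}, IsSeriesLimit BY f (z : PiAdic π R) y → g z = y :=
    fun h => (hg _).unique hε0 hε1 hBY.1 hf h
  refine ⟨{ toFun := g, map_add' := fun x y => ?_, map_smul' := fun v x => ?_ }, ?_, ?_⟩
  · exact huniq ((hg x).add (hg y))
  · exact huniq ((hg x).smul v)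
  · intro T hT
    obtain ⟨M, c, hM, h1, hc, h⟩ := bdd_daggerBornology.1 hT
    obtain ⟨S, hS, hSz⟩ := exists_bdd_forall_isSeriesLimit hε0 hε1 hBY hf hM h1 hc
    refine hS.subset ?_
    rintro _ ⟨z, hz, rfl⟩
    obtain ⟨y, hy, hlim⟩ := hSz z (h z hz)
    change g z ∈ S
    rwa [huniq hlim]
  · ext r
    exact huniq (isSeriesLimit_algebraMap BY f r)

/-- The image of `R` is bornologically dense in `R†`, bounded linear maps preserve bornological
limits, and limits in `Y` are unique. -/
theorem dagger_hom_ext {BY : ConvexBornology V Y} (hBY : IsSeparated π BY)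
    {g g' : dagger π R →ₗ[V] Y} (hg : IsBoundedMap (daggerBornology π R) BY g)
    (hg' : IsBoundedMap (daggerBornology π R) BY g')
    (h : g ∘ₗ (toDagger π R).toLinearMap = g' ∘ₗ (toDagger π R).toLinearMap) : g = g' := by
  ext z
  obtain ⟨M, c, hM, h1, hc, w, hw, hz⟩ := mem_dagger.1 z.2
  have hlim := bornConverges_toDagger_partialSum hM h1 hc hw hz
  have hlim' := hlim.map hg'
  have : (fun n => g' (toDagger π R (partialSum π w n))) =
      fun n => g (toDagger π R (partialSum π w n)) :=
    funext fun n => (LinearMap.congr_fun h (partialSum π w n)).symm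
  rw [this] at hlim'
  exact (hlim.map hg).unique hBY hlim'

end Extension

theorem isCompletion_dagger {V : Type v} [CommRing V] [IsNoetherianRing V] (π : V) {ε : ℝ}
    (hε0 : 0 < ε) (hε1 : ε < 1) (R : Type u) [CommRing R] [Algebra V R] [Algebra.FiniteType V R] :
    IsCompletion.{t} π (linearGrowth π ε (fineBornology V R)) (daggerBornology π R)
      (toDagger π R).toLinearMap := by
  refine ⟨isComplete_dagger, isBoundedMap_toDagger hε0 hε1, fun Y _ _ BY hBY f hf => ?_⟩
  obtain ⟨g, hg, hgf⟩ := exists_extension hε0 hε1 hBY hf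
  exact ⟨g, ⟨hg, hgf⟩, fun g' h' => dagger_hom_ext hBY.1 h'.1 hg (h'.2.trans hgf.symm)⟩

/-! ### Uniqueness of completions as bornological algebras -/

section Uniqueness

theorem IsBoundedMap.comp {V : Type*} [CommRing V] {M N P : Type*} [AddCommGroup M] [Module V M]
    [AddCommGroup N] [Module V N] [AddCommGroup P] [Module V P] {B : ConvexBornology V M}
    {B' : ConvexBornology V N} {B'' : ConvexBornology V P} {g : N →ₗ[V] P} {f : M →ₗ[V] N}
    (hg : IsBoundedMap B' B'' g) (hf : IsBoundedMap B B' f) : IsBoundedMap B B'' (g ∘ₗ f) :=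
  fun S hS => by
    rw [LinearMap.coe_comp, Set.image_comp]
    exact hg _ (hf S hS)

theorem isBoundedMap_id {V : Type*} [CommRing V] {M : Type*} [AddCommGroup M] [Module V M]
    (B : ConvexBornology V M) : IsBoundedMap B B (LinearMap.id : M →ₗ[V] M) := fun S hS => by
  simpa using hS

theorem IsAlgebraBornology.isBoundedMap_mulLeft {V : Type*} [CommRing V] {C : Type*} [Ring C]
    [Algebra V C] {B : ConvexBornology V C} (hB : IsAlgebraBornology B) (a : C) :
    IsBoundedMap B B (LinearMap.mulLeft V a) := fun S hS =>
  (hB {a} S (B.bdd_singleton a) hS).subset (by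
    rintro _ ⟨x, hx, rfl⟩
    exact Set.mul_mem_mul rfl hx)

theorem IsAlgebraBornology.isBoundedMap_mulRight {V : Type*} [CommRing V] {C : Type*} [Ring C]
    [Algebra V C] {B : ConvexBornology V C} (hB : IsAlgebraBornology B) (a : C) :
    IsBoundedMap B B (LinearMap.mulRight V a) := fun S hS =>
  (hB S {a} hS (B.bdd_singleton a)).subset (by
    rintro _ ⟨x, hx, rfl⟩
    exact Set.mul_mem_mul hx rfl)

theorem IsCompletion.hom_ext.{w, x, y, z} {V : Type x} [CommRing V] {M : Type y} [AddCommGroup M]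
    [Module V M] {N : Type z} [AddCommGroup N] [Module V N] {π : V} {B : ConvexBornology V M}
    {B' : ConvexBornology V N} {ι : M →ₗ[V] N} (h : IsCompletion.{w} π B B' ι) {Y : Type w}
    [AddCommGroup Y] [Module V Y] {BY : ConvexBornology V Y} (hBY : IsComplete π BY)
    {g g' : N →ₗ[V] Y} (hg : IsBoundedMap B' BY g) (hg' : IsBoundedMap B' BY g')
    (hgg' : ∀ m, g (ι m) = g' (ι m)) : g = g' :=
  (h.2.2 Y BY hBY (g' ∘ₗ ι) (hg'.comp h.2.1)).unique ⟨hg, LinearMap.ext hgg'⟩ ⟨hg', rfl⟩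

/-- Two completions of a bornological algebra that are bornological algebras are isomorphic. -/
theorem IsCompletion.exists_algEquiv {V : Type v} [CommRing V] {π : V} {R : Type u} [Ring R]
    [Algebra V R] {B : ConvexBornology V R} {C D : Type u} [Ring C] [Algebra V C] [Ring D]
    [Algebra V D] {BC : ConvexBornology V C} {BD : ConvexBornology V D} {ι : R →ₐ[V] C}
    {j : R →ₐ[V] D} (hC : IsAlgebraBornology BC) (hD : IsAlgebraBornology BD)
    (hι : IsCompletion.{u} π B BC ι.toLinearMap) (hj : IsCompletion.{u} π B BD j.toLinearMap) :
    ∃ φ : C ≃ₐ[V] D, IsBoundedMap BC BD φ ∧ IsBoundedMap BD BC φ.symm ∧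
      (∀ r : R, φ (ι r) = j r) ∧
      ∀ g : C →ₗ[V] D, IsBoundedMap BC BD g → (∀ r : R, g (ι r) = j r) → g = φ.toLinearMap := by
  obtain ⟨f, ⟨hf, hfι⟩, hfu⟩ := hι.2.2 D BD hj.1 j.toLinearMap hj.2.1
  obtain ⟨g, ⟨hg, hgj⟩, -⟩ := hj.2.2 C BC hι.1 ι.toLinearMap hι.2.1
  have hfι' : ∀ r, f (ι r) = j r := LinearMap.congr_fun hfι
  have hgj' : ∀ r, g (j r) = ι r := LinearMap.congr_fun hgj
  have hgf : g ∘ₗ f = LinearMap.id :=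
    hι.hom_ext hι.1 (hg.comp hf) (isBoundedMap_id BC) fun r => by simp [hfι', hgj']
  have hfg : f ∘ₗ g = LinearMap.id :=
    hj.hom_ext hj.1 (hf.comp hg) (isBoundedMap_id BD) fun r => by simp [hfι', hgj']
  -- Multiplicativity is extended from `R` one factor at a time: with the other factor fixed, both
  -- sides are bounded linear maps on `C` that agree on the image of `R`.
  have hmul₁ : ∀ r c, f (ι r * c) = j r * f c := fun r =>
    LinearMap.congr_fun (hι.hom_ext hj.1 (hf.comp (hC.isBoundedMap_mulLeft (ι r)))
      ((hD.isBoundedMap_mulLeft (j r)).comp hf) fun s => by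
        simp [← map_mul, hfι'] : f ∘ₗ LinearMap.mulLeft V (ι r) = LinearMap.mulLeft V (j r) ∘ₗ f)
  have hmul : ∀ x c, f (x * c) = f x * f c := fun x c =>
    LinearMap.congr_fun (hι.hom_ext hj.1 (hf.comp (hC.isBoundedMap_mulRight c))
      ((hD.isBoundedMap_mulRight (f c)).comp hf) fun s => by
        simp [hmul₁, hfι'] : f ∘ₗ LinearMap.mulRight V c = LinearMap.mulRight V (f c) ∘ₗ f) x
  have hone : f 1 = 1 := by rw [← map_one ι, hfι', map_one]
  refine ⟨AlgEquiv.ofLinearEquiv (LinearEquiv.ofLinearMap f g hfg hgf) hone hmul, hf, hg, hfι',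
    fun g' hg' h => ?_⟩
  exact hfu g' ⟨hg', LinearMap.ext h⟩

end Uniqueness

end MW

theorem mainTheorem3 {V : Type v} [CommRing V] [IsDomain V] [IsDiscreteValuationRing V]
    [IsAdicComplete (IsLocalRing.maximalIdeal V) V]
    (π : V) (hπ : Irreducible π) (ε : ℝ) (hε0 : 0 < ε) (hε1 : ε < 1)
    (R : Type u) [CommRing R] [Algebra V R] [Algebra.FiniteType V R] :
    MW.IsAlgebraBornology (MW.daggerBornology π R) ∧
    MW.IsCompletion.{t} π (MW.linearGrowth π ε (MW.fineBornology V R)) (MW.daggerBornology π R)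
      (MW.toDagger π R).toLinearMap ∧
    ∀ (C : Type u) [Ring C] [Algebra V C] (BC : MW.ConvexBornology V C) (ι : R →ₐ[V] C),
      MW.IsAlgebraBornology BC →
      MW.IsCompletion.{u} π (MW.linearGrowth π ε (MW.fineBornology V R)) BC ι.toLinearMap →
      ∃ φ : C ≃ₐ[V] MW.dagger π R,
        MW.IsBoundedMap BC (MW.daggerBornology π R) φ ∧
        MW.IsBoundedMap (MW.daggerBornology π R) BC φ.symm ∧
        (∀ r : R, φ (ι r) = MW.toDagger π R r) ∧
        ∀ g : C →ₗ[V] MW.dagger π R, MW.IsBoundedMap BC (MW.daggerBornology π R) g →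
          (∀ r : R, g (ι r) = MW.toDagger π R r) → g = φ.toLinearMap := by
  refine ⟨MW.isAlgebraBornology_dagger, MW.isCompletion_dagger π hε0 hε1 R,
    fun C _ _ BC ι hBC hι => ?_⟩
  exact hι.exists_algEquiv hBC MW.isAlgebraBornology_dagger (MW.isCompletion_dagger π hε0 hε1 R)
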